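/- **Conventions.** All locally convex spaces are Hausdorff, over $\mathbb{K}\in\{\mathbb{R},\mathbb{C}\}$. A set $\Gamma$ of continuous seminorms on a locally convex space $X$ is a *fundamental system* if for every continuous seminorm $q$ on $X$ there are $p\in\Gamma$ and $M\geqslant0$ with $q\leqslant Mp$. A *$C_0$-semigroup* on $X$ is a family $(T(t))_{t\geqslant0}$ of continuous linear operators on $X$ with $T(0)=\mathrm{id}_X$, $T(t+s)=T(t)T(s)$ for $t,s\geqslant0$, and $t\mapsto T(t)x$ continuous on $[0,\infty)$ for every $x\in X$. It is *locally equicontinuous* if $\{T(t):t\in[0,t_1]\}$ is equicontinuous for every $t_1>0$. Its *generator* is the linear operator $Ax=\lim_{t\searrow0}\frac{T(t)x-x}{t}$ with domain $D(A)=\{x\in X:\lim_{t\searrow0}\frac{T(t)x-x}{t}\text{ exists}\}$. Integrals of vector-valued functions are Riemann integrals. **Theorem.** Let $A\colon D(A)\to X$ be the generator of a locally equicontinuous $C_0$-semigroup $(T(t))_{t\geqslant0}$ on a sequentially complete locally convex space $X$, and let $\Gamma$ be a fundamental system of continuous seminorms on $X$. Let $\bar X$ be a sequentially complete locally convex space such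 that (a) $X\subseteq\bar X$ is a dense linear subspace and the inclusion map is continuous, (b) $\bar A$ generates a locally equicontinuous $C_0$-semigroup $(\bar T(t))_{t\geqslant0}$ on $\bar X$ such that $\bar T(t)|_X=T(t)$ for all $t\geqslant0$, and $D(\bar A)=X$. Let $B\colon X\to\bar X$ be linear and continuous and let $t_0>0$ be a number such that (c) for every $f\in C([0,t_0],X)$, the integral $\int_0^{t_0}\bar T(t_0-t)Bf(t)\,dt$ (taken in $\bar X$) belongs to $X$, (d) for every $p\in\Gamma$ there is $K\in(0,1)$ such that for all $f\in C([0,t_0],X)$ $$p\Bigl(\int_0^{t_0}\bar T(t_0-t)Bf(t)\,dt\Bigr)\leqslant K\sup_{t\in[0,t_0]}p(f(t)).$$ Then the operator $C\colon D(C)\to X$ defined by $$Cx=(\bar A+B)x\quad\text{for}\quad x\in D(C)=\{x\in X:(\bar A+B)x\in X\}$$ generates a locally equicontinuous $C_0$-semigroup on $X$ if and only if $D(C)$ is dense in $X$. -/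

import Mathlib

open Filter Topology Set
open scoped NNReal

/-- Every Cauchy sequence converges. -/
def SeqComplete (X : Type*) [UniformSpace X] : Prop :=
  ∀ u : ℕ → X, CauchySeq u → ∃ x, Tendsto u atTop (𝓝 x)

/-- `Γ` is a fundamental system of continuous seminorms: its members are continuous, and every
continuous seminorm is dominated by a multiple of a member of `Γ`. -/
def IsFundamentalSystem {𝕜 X : Type*} [RCLike 𝕜] [AddCommGroup X] [Module 𝕜 X]
    [TopologicalSpace X] (Γ : Set (Seminorm 𝕜 X)) : Prop :=
  (∀ p ∈ Γ, Continuous p) ∧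
    ∀ q : Seminorm 𝕜 X, Continuous q → ∃ p ∈ Γ, ∃ M : ℝ≥0, q ≤ M • p

/-- A locally equicontinuous `C₀`-semigroup of continuous linear operators. -/
structure IsLocallyEquicontinuousC0Semigroup {𝕜 X : Type*} [RCLike 𝕜] [AddCommGroup X]
    [Module 𝕜 X] [UniformSpace X] (T : ℝ≥0 → X →L[𝕜] X) : Prop where
  map_zero : T 0 = ContinuousLinearMap.id 𝕜 X
  map_add : ∀ t s : ℝ≥0, T (t + s) = (T t).comp (T s)
  continuous_orbit : ∀ x : X, Continuous fun t : ℝ≥0 => T t x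
  locally_equicontinuous : ∀ t₀ : ℝ≥0, Equicontinuous fun (t : Set.Icc 0 t₀) (x : X) => T t x

/-- `A` is the generator of `T`: `x ∈ D(A)` and `A x = y` if and only if
`(T t x - x) / t` tends to `y` as `t ↘ 0`. -/
def IsGeneratorOf {𝕜 X : Type*} [RCLike 𝕜] [AddCommGroup X] [Module 𝕜 X] [Module ℝ X]
    [TopologicalSpace X] (A : X →ₗ.[𝕜] X) (T : ℝ≥0 → X →L[𝕜] X) : Prop :=
  ∀ x y : X, (x, y) ∈ A.graph ↔
    Tendsto (fun t : ℝ≥0 => (t : ℝ)⁻¹ • (T t x - x)) (𝓝[>] 0) (𝓝 y)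

/-- `y` is the Riemann integral of `g` over `[a, b]`: the Riemann sums
`∑ i < n, (u (i + 1) - u i) • g (ξ i)` tend to `y` as the mesh of the tagged partition
`a = u 0 ≤ ξ 0 ≤ u 1 ≤ ξ 1 ≤ ⋯ ≤ u n = b` tends to `0`. -/
def HasRiemannIntegral {Y : Type*} [AddCommGroup Y] [Module ℝ Y] [TopologicalSpace Y]
    (g : ℝ → Y) (a b : ℝ) (y : Y) : Prop :=
  ∀ U ∈ 𝓝 y, ∃ δ : ℝ, 0 < δ ∧ ∀ (n : ℕ) (u ξ : ℕ → ℝ), u 0 = a → u n = b →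
    (∀ i < n, u i ≤ ξ i ∧ ξ i ≤ u (i + 1) ∧ u (i + 1) - u i < δ) →
      ∑ i ∈ Finset.range n, (u (i + 1) - u i) • g (ξ i) ∈ U

section Part

variable {𝕜 X Y : Type*} [RCLike 𝕜] [AddCommGroup X] [Module 𝕜 X] [TopologicalSpace X]
  [AddCommGroup Y] [Module 𝕜 Y] [TopologicalSpace Y]

/-- For an operator `Abar` in `Y` whose domain is the subspace `X` (included by `ι`) and for
`B : X → Y`, the linear map `x ↦ Abar x + B x` from `X` to `Y`. -/
def perturbedOperator (ι : X →L[𝕜] Y) (Abar : Y →ₗ.[𝕜] Y)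
    (hdom : Abar.domain = LinearMap.range (ι : X →ₗ[𝕜] Y)) (B : X →L[𝕜] Y) : X →ₗ[𝕜] Y :=
  Abar.toFun ∘ₗ (ι : X →ₗ[𝕜] Y).codRestrict Abar.domain
    (fun x => hdom ▸ LinearMap.mem_range_self (ι : X →ₗ[𝕜] Y) x) + (B : X →ₗ[𝕜] Y)

/-- The part in `X` (included in `Y` by `ι`) of a linear map `S : X → Y`: the domain is
`{x | S x ∈ X}`, and the value at `x` is `S x` regarded as an element of `X`. -/
noncomputable def partIn (ι : X →L[𝕜] Y) (hι : Function.Injective ι) (S : X →ₗ[𝕜] Y) :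
    X →ₗ.[𝕜] X where
  domain := (LinearMap.range (ι : X →ₗ[𝕜] Y)).comap S
  toFun := (LinearEquiv.ofInjective (ι : X →ₗ[𝕜] Y) hι).symm.toLinearMap ∘ₗ
    (S ∘ₗ ((LinearMap.range (ι : X →ₗ[𝕜] Y)).comap S).subtype).codRestrict
      (LinearMap.range (ι : X →ₗ[𝕜] Y)) (fun x => x.2)

theorem perturbedOperator_apply (ι : X →L[𝕜] Y) (Abar : Y →ₗ.[𝕜] Y)
    (hdom : Abar.domain = LinearMap.range (ι : X →ₗ[𝕜] Y)) (B : X →L[𝕜] Y) (x : X)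
    (hx : ι x ∈ Abar.domain) :
    perturbedOperator ι Abar hdom B x = Abar ⟨ι x, hx⟩ + B x := rfl

theorem mem_graph_partIn (ι : X →L[𝕜] Y) (hι : Function.Injective ι) (S : X →ₗ[𝕜] Y)
    (x y : X) : (x, y) ∈ (partIn ι hι S).graph ↔ ι y = S x := by
  have key : ∀ z : (partIn ι hι S).domain, ι (partIn ι hι S z) = S z := fun z =>
    congrArg Subtype.val ((LinearEquiv.ofInjective (ι : X →ₗ[𝕜] Y) hι).apply_symm_apply
      ⟨S z, z.2⟩)
  rw [LinearPMap.mem_graph_iff]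
  constructor
  · rintro ⟨z, rfl, rfl⟩
    exact key z
  · intro h
    exact ⟨⟨x, ⟨y, h⟩⟩, rfl, hι ((key ⟨x, ⟨y, h⟩⟩).trans h.symm)⟩

end Part

/-!
The idea is to build the perturbed semigroup `S` from the variation of constants formula
`S t x = T t x + ∫₀ᵗ Tbar (t - s) (B (S s x)) ds`, a fixed point equation for the Volterra operator
`V f t = ∫₀ᵗ Tbar (t - s) (B (f s)) ds` on continuous functions `[0, t₀] → X`.

The hypotheses concern `V f t₀` only. For `f` with `f 0 = 0` they pass to `V f t` with `t ≤ t₀`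
by delaying `f`, which also makes `V f` continuous into `X`. For a constant function `V` lands in
the domain of `Abar`, which is `X`; since nothing relates the topology of `X` to the graph topology
of `Abar`, the continuity of `V` on constants is deduced from the case `f 0 = 0` by means of the
cocycle identity `V f (t + s) = T t (V f s) + V (f (· + s)) t` (`continuousOn_const`). The
contraction estimate `p (V f t) ≤ K sup p (f s)` for every `f` and `t` is obtained by
removing a cut-off of `f 0` supported in `[0, ε]`. The value of `V` on this cut-off is expressed
through averages over `[0, ε]` of the values on constants, and tends to `0` (`seminorm_le`).

With this estimate the Picard iterates converge seminorm by seminorm, the solution is unique and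
depends equicontinuously on `x`, and uniqueness gives the semigroup law on `[0, t₀]`; a local
semigroup extends to `[0, ∞)` (`exists_semigroup_of_local`). Differentiating the Volterra equation
at `0` in `Xbar` shows that the generator of `S` is contained in the part of `Abar + B` in `X`.
Conversely, if `Abar x + B x = y ∈ X`, then `x + ∫₀ᵗ S s y ds` solves the same equation as `S t x`,
because `V` commutes with integration in time (`isVolterra_of_hasWeakIntegral`); hence `S t x` is
differentiable at `0` with derivative `y`. So the part of `Abar + B` in `X` is a generator. Its
domain is therefore dense, as averages of orbits lie in the domain of a generator
(`IsGeneratorOf.dense_domain`): both sides of the equivalence hold.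

Integrals are handled weakly: the integral of `g` is the vector `y` with `∫ Λ (g s) ds = Λ y` for
all continuous real-linear functionals `Λ`. The Hahn–Banach theorem turns this into uniqueness and
into seminorm estimates, and reduces Fubini's theorem and the fundamental theorem of calculus to
real-valued functions.
-/

/-! ### Continuous seminorms and duality -/

section Duality

open scoped ComplexOrder in
/-- A real locally convex topology on a `𝕜`-vector space is given by `𝕜`-seminorms. -/
theorem polynormableSpace_of_locallyConvexSpace_real (𝕜 Y : Type*) [RCLike 𝕜] [AddCommGroup Y]
    [Module 𝕜 Y] [Module ℝ Y] [IsScalarTower ℝ 𝕜 Y] [TopologicalSpace Y] [IsTopologicalAddGroup Y]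
    [ContinuousSMul 𝕜 Y] [LocallyConvexSpace ℝ Y] : PolynormableSpace 𝕜 Y := by
  have : ContinuousSMul ℝ Y := IsScalarTower.continuousSMul 𝕜
  have : LocallyConvexSpace 𝕜 Y := by
    refine (locallyConvexSpace_iff_exists_convex_subset_zero 𝕜 Y).2 fun U hU => ?_
    obtain ⟨S, hS, hc, hSU⟩ := (locallyConvexSpace_iff_exists_convex_subset_zero ℝ Y).1 ‹_› U hU
    exact ⟨S, hS, convex_of_nonneg_surjective_algebraMap _
      (fun _ => RCLike.nonneg_iff_exists_ofReal.mp) hc, hSU⟩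
  infer_instance

theorem IsFundamentalSystem.withSeminorms {𝕜 X : Type*} [RCLike 𝕜] [AddCommGroup X] [Module 𝕜 X]
    [TopologicalSpace X] [IsTopologicalAddGroup X] [PolynormableSpace 𝕜 X]
    {Γ : Set (Seminorm 𝕜 X)} (hΓ : IsFundamentalSystem Γ) :
    WithSeminorms (fun p : Γ => (p : Seminorm 𝕜 X)) := by
  refine (PolynormableSpace.withSeminorms 𝕜 X).congr (fun p => ?_) (fun q => ?_)
  · exact ⟨{⟨p.1, hΓ.1 p.1 p.2⟩}, 1, fun x => by simp⟩
  · obtain ⟨p, hp, M, h⟩ := hΓ.2 q.1 q.2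
    exact ⟨{⟨p, hp⟩}, M, fun x => by simpa using! h x⟩

variable {Y : Type*} [AddCommGroup Y] [Module ℝ Y] [TopologicalSpace Y] [IsTopologicalAddGroup Y]
  [ContinuousSMul ℝ Y] [LocallyConvexSpace ℝ Y]

/-- Hahn–Banach: a continuous seminorm is attained at a given vector by a functional
which it dominates. -/
theorem exists_dual_eq_seminorm {p : Seminorm ℝ Y} (hp : Continuous p) (z : Y) :
    ∃ Λ : Y →L[ℝ] ℝ, (∀ w, |Λ w| ≤ p w) ∧ Λ z = p z := by
  by_cases hz : z = 0
  · exact ⟨0, fun w => by simp, by simp [hz]⟩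
  let e := LinearEquiv.toSpanNonzeroSingleton ℝ Y z hz
  obtain ⟨g, hg, hgp⟩ := Module.Dual.exists_continuous_extension_of_le_seminorm_real
    (ℝ ∙ z) ((p z • LinearMap.id : ℝ →ₗ[ℝ] ℝ) ∘ₗ e.symm.toLinearMap) hp (by
      intro x
      obtain ⟨c, rfl⟩ := e.surjective x
      have : ((e c : ℝ ∙ z) : Y) = c • z := rfl
      simp only [LinearMap.comp_apply, LinearEquiv.coe_coe, LinearEquiv.symm_apply_apply, this,
        map_smul_eq_mul]
      simp only [LinearMap.smul_apply, LinearMap.id_apply, smul_eq_mul, Real.norm_eq_abs, mul_comm]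
      exact mul_le_mul_of_nonneg_right (le_abs_self c) (apply_nonneg p z))
  refine ⟨g, hgp, ?_⟩
  have h1 : ((e 1 : ℝ ∙ z) : Y) = z := one_smul ℝ z
  have := hg (e 1)
  rw [h1] at this
  simpa using this

theorem eq_of_forall_dual [T2Space Y] {x y : Y} (h : ∀ Λ : Y →L[ℝ] ℝ, Λ x = Λ y) : x = y := by
  by_contra hxy
  obtain ⟨f, hf⟩ := geometric_hahn_banach_point_point (E := Y) hxy
  exact hf.ne (h f)

theorem tendsto_nhds_iff_seminorm {α : Type*} {l : Filter α} {u : α → Y} {y : Y} :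
    Tendsto u l (𝓝 y) ↔
      ∀ p : Seminorm ℝ Y, Continuous p → ∀ ε > 0, ∀ᶠ a in l, p (u a - y) < ε :=
  ((PolynormableSpace.withSeminorms ℝ Y).tendsto_nhds u y).trans
    ⟨fun h p hp => h ⟨p, hp⟩, fun h p => h p.1 p.2⟩

end Duality

theorem WithSeminorms.cauchySeq {𝕜 Y I : Type*} [RCLike 𝕜] [AddCommGroup Y] [Module 𝕜 Y]
    [UniformSpace Y] [IsUniformAddGroup Y] {p : I → Seminorm 𝕜 Y} (hp : WithSeminorms p)
    {u : ℕ → Y} (h : ∀ i, ∀ ε > 0, ∃ N, ∀ m ≥ N, ∀ n ≥ N, p i (u m - u n) < ε) :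
    CauchySeq u := by
  rw [cauchySeq_iff_tendsto, uniformity_eq_comap_nhds_zero, tendsto_comap_iff, hp.tendsto_nhds]
  intro i ε hε
  obtain ⟨N, hN⟩ := h i ε hε
  filter_upwards [eventually_ge_atTop (N, N)] with a ha
  simpa [sub_zero] using hN a.2 ha.2 a.1 ha.1

/-! ### Scalar integrals -/

section Scalar

open MeasureTheory

theorem abs_riemannSum_sub_integral_le {φ : ℝ → ℝ} {a b c δ : ℝ} (hab : a ≤ b)
    (hφ : ContinuousOn φ (Icc a b))
    (h : ∀ s ∈ Icc a b, ∀ r ∈ Icc a b, |s - r| ≤ δ → |φ s - φ r| ≤ c)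
    {n : ℕ} (hn : 0 < n) (hδ : (b - a) / n ≤ δ) :
    |∑ i ∈ Finset.range n, (b - a) / n * φ (a + i * ((b - a) / n)) - ∫ s in a..b, φ s| ≤
      (b - a) * c := by
  have hn' : (0 : ℝ) < n := by exact_mod_cast hn
  set d := (b - a) / n with hd
  have hd0 : 0 ≤ d := div_nonneg (sub_nonneg.2 hab) hn'.le
  have hnd : n * d = b - a := by rw [hd]; field_simp
  set u : ℕ → ℝ := fun i => a + i * d with hu
  have hmem : ∀ i ≤ n, u i ∈ Icc a b := fun i hi => by
    have h1 : (i : ℝ) * d ≤ n * d := mul_le_mul_of_nonneg_right (by exact_mod_cast hi) hd0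
    have h2 : 0 ≤ (i : ℝ) * d := by positivity
    constructor <;> simp only [hu] <;> linarith
  have hstep : ∀ i, u (i + 1) = u i + d := fun i => by simp only [hu]; push_cast; ring
  have hint : ∀ i < n, IntervalIntegrable φ volume (u i) (u (i + 1)) := fun i hi => by
    refine (hφ.mono ?_).intervalIntegrable
    rw [uIcc_of_le (by rw [hstep]; linarith)]
    exact Icc_subset_Icc (hmem i hi.le).1 (hmem (i + 1) hi).2
  have hsum : ∫ s in a..b, φ s = ∑ i ∈ Finset.range n, ∫ s in (u i)..(u (i + 1)), φ s := by
    rw [intervalIntegral.sum_integral_adjacent_intervals hint]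
    simp [hu, hnd]
  rw [hsum, ← Finset.sum_sub_distrib]
  refine (Finset.abs_sum_le_sum_abs _ _).trans ?_
  have hterm : ∀ i ∈ Finset.range n,
      |d * φ (a + i * d) - ∫ s in (u i)..(u (i + 1)), φ s| ≤ d * c := by
    intro i hi
    have hi := Finset.mem_range.1 hi
    have e : d * φ (a + i * d) - ∫ s in (u i)..(u (i + 1)), φ s =
        ∫ s in (u i)..(u (i + 1)), (φ (u i) - φ s) := by
      rw [intervalIntegral.integral_sub (by simp) (hint i hi)]
      rw [intervalIntegral.integral_const, hstep, add_sub_cancel_left, smul_eq_mul]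
    rw [e, ← Real.norm_eq_abs]
    refine (intervalIntegral.norm_integral_le_of_norm_le_const (C := c) fun s hs => ?_).trans ?_
    · rw [uIoc_of_le (by rw [hstep]; linarith), hstep] at hs
      have hs' : s ∈ Icc a b := ⟨(hmem i hi.le).1.trans hs.1.le,
        (hs.2.trans_eq (hstep i).symm).trans (hmem (i + 1) hi).2⟩
      refine h _ (hmem i hi.le) _ hs' (le_trans ?_ hδ)
      rw [abs_le]; constructor <;> linarith [hs.1, hs.2]
    · rw [hstep, add_sub_cancel_left, abs_of_nonneg hd0, mul_comm]
  refine (Finset.sum_le_sum hterm).trans (le_of_eq ?_)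
  rw [Finset.sum_const, Finset.card_range, nsmul_eq_mul, ← mul_assoc, hnd]

theorem tendsto_riemannSum {φ : ℝ → ℝ} {a b : ℝ} (hab : a ≤ b) (hφ : ContinuousOn φ (Icc a b)) :
    Tendsto (fun n : ℕ => ∑ i ∈ Finset.range n, (b - a) / n * φ (a + i * ((b - a) / n))) atTop
      (𝓝 (∫ s in a..b, φ s)) := by
  rw [Metric.tendsto_atTop]
  intro ε hε
  have hc : 0 < ε / (b - a + 1) := div_pos hε (by linarith)
  obtain ⟨δ, hδ, h⟩ := Metric.uniformContinuousOn_iff_le.1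
    (isCompact_Icc.uniformContinuousOn_of_continuous hφ) _ hc
  obtain ⟨N, hN⟩ := exists_nat_ge ((b - a) / δ)
  refine ⟨N + 1, fun n hn => ?_⟩
  have hn0 : 0 < n := by omega
  have hn' : (0 : ℝ) < n := by exact_mod_cast hn0
  have hNn : (N : ℝ) ≤ n := by exact_mod_cast (by omega : N ≤ n)
  have hmesh : (b - a) / n ≤ δ := by
    rw [div_le_iff₀ hn']
    have := (div_le_iff₀ hδ).1 (hN.trans hNn)
    linarith
  refine (abs_riemannSum_sub_integral_le hab hφ
    (fun s hs r hr hsr => h s hs r hr hsr) hn0 hmesh).trans_lt ?_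
  rw [mul_div_assoc', div_lt_iff₀ (by linarith)]
  nlinarith

/-- Fubini's theorem on a triangle, in convolution form. -/
theorem integral_integral_triangle {k : ℝ → ℝ → ℝ} (hk : Continuous (Function.uncurry k))
    {t : ℝ} (ht : 0 ≤ t) :
    ∫ s in (0 : ℝ)..t, ∫ r in (0 : ℝ)..s, k (t - s) r =
      ∫ s in (0 : ℝ)..t, ∫ r in (0 : ℝ)..s, k (s - r) r := by
  have swap : ∀ h : ℝ → ℝ → ℝ, Continuous (Function.uncurry h) →
      ∫ s in (0 : ℝ)..t, ∫ r in (0 : ℝ)..s, h s r =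
        ∫ r in (0 : ℝ)..t, ∫ s in r..t, h s r := by
    intro h hh
    let D : Set (ℝ × ℝ) := {q | q.2 ≤ q.1}
    have hD : MeasurableSet D := measurableSet_le measurable_snd measurable_fst
    have key := MeasureTheory.intervalIntegral_intervalIntegral_swap (a := 0) (b := t) (c := 0)
      (d := t) (F := fun s r => D.indicator (Function.uncurry h) (s, r)) (by
        refine IntegrableOn.mono_set (t := Icc 0 t ×ˢ Icc 0 t) ?_ ?_
        · exact (hh.continuousOn.integrableOn_compact (isCompact_Icc.prod isCompact_Icc)).indicator
            hD
        · rw [uIoc_of_le ht]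
          exact prod_mono Ioc_subset_Icc_self Ioc_subset_Icc_self)
    have left : ∀ s ∈ uIcc 0 t, ∫ r in (0 : ℝ)..t, D.indicator (Function.uncurry h) (s, r) =
        ∫ r in (0 : ℝ)..s, h s r := by
      intro s hs
      rw [uIcc_of_le ht] at hs
      rw [intervalIntegral.integral_of_le ht, intervalIntegral.integral_of_le hs.1]
      have : (fun r => D.indicator (Function.uncurry h) (s, r)) =
          (Iic s).indicator (h s) := by
        ext r; simp [D, indicator, Function.uncurry]
      rw [this, setIntegral_indicator measurableSet_Iic]
      congr 2
      ext r; simp only [mem_inter_iff, mem_Ioc, mem_Iic]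
      exact ⟨fun q => ⟨q.1.1, q.2⟩, fun q => ⟨⟨q.1, q.2.trans hs.2⟩, q.2⟩⟩
    have right : ∀ r ∈ uIcc 0 t, ∫ s in (0 : ℝ)..t, D.indicator (Function.uncurry h) (s, r) =
        ∫ s in r..t, h s r := by
      intro r hr
      rw [uIcc_of_le ht] at hr
      rw [intervalIntegral.integral_of_le ht, intervalIntegral.integral_of_le hr.2]
      have : (fun s => D.indicator (Function.uncurry h) (s, r)) =
          (Ici r).indicator (fun s => h s r) := by
        ext s; simp [D, indicator, Function.uncurry]
      rw [this, setIntegral_indicator measurableSet_Ici, ← integral_Icc_eq_integral_Ioc]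
      -- the two domains differ at most by the point `0`
      rw [setIntegral_congr_set (Ioc_ae_eq_Icc.inter (ae_eq_refl (Ici r)))]
      congr 2
      ext s; simp only [mem_inter_iff, mem_Icc, mem_Ici]
      exact ⟨fun q => ⟨q.2, q.1.2⟩, fun q => ⟨⟨hr.1.trans q.1, q.2⟩, q.1⟩⟩
    rw [← intervalIntegral.integral_congr left, ← intervalIntegral.integral_congr right]
    exact key
  rw [swap (fun s r => k (t - s) r) (hk.comp (by fun_prop : Continuous fun q : ℝ × ℝ =>
      ((t - q.1, q.2) : ℝ × ℝ))),
    swap (fun s r => k (s - r) r) (hk.comp (by fun_prop : Continuous fun q : ℝ × ℝ =>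
      ((q.1 - q.2, q.2) : ℝ × ℝ)))]
  refine intervalIntegral.integral_congr fun r _ => ?_
  rw [intervalIntegral.integral_comp_sub_left (fun x => k x r),
    intervalIntegral.integral_comp_sub_right (fun x => k x r)]
  simp

end Scalar

/-! ### Weak integrals -/

section WeakIntegral

open MeasureTheory

variable {Y : Type*} [AddCommGroup Y] [Module ℝ Y]

/-- `y` is the integral of `g` over `[a, b]` in the weak sense: every continuous real-linear
functional commutes with the integral. -/
def HasWeakIntegral [TopologicalSpace Y] (g : ℝ → Y) (a b : ℝ) (y : Y) : Prop :=
  ∀ Λ : Y →L[ℝ] ℝ, ∫ s in a..b, Λ (g s) = Λ y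

section Topological

variable [TopologicalSpace Y] {g : ℝ → Y} {a b : ℝ} {y z : Y}

theorem HasRiemannIntegral.hasWeakIntegral (hab : a ≤ b) (hg : ContinuousOn g (Icc a b))
    (h : HasRiemannIntegral g a b y) : HasWeakIntegral g a b y := by
  intro Λ
  refine tendsto_nhds_unique (tendsto_riemannSum hab (Λ.continuous.comp_continuousOn hg)) ?_
  have hsum : Tendsto (fun n : ℕ => ∑ i ∈ Finset.range n,
      ((b - a) / n) • g (a + i * ((b - a) / n))) atTop (𝓝 y) := by
    rw [tendsto_def]
    intro U hU
    obtain ⟨δ, hδ, hU⟩ := h U hU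
    obtain ⟨N, hN⟩ := exists_nat_gt ((b - a) / δ)
    filter_upwards [eventually_ge_atTop (N + 1)] with n hn
    have hn0 : (0 : ℝ) < n := by exact_mod_cast (by omega : 0 < n)
    have hNn : (N : ℝ) ≤ n := by exact_mod_cast (by omega : N ≤ n)
    have hd0 : 0 ≤ (b - a) / n := div_nonneg (sub_nonneg.2 hab) hn0.le
    have hmesh : (b - a) / n < δ := by
      rw [div_lt_iff₀ hn0]
      have := (div_lt_iff₀ hδ).1 (hN.trans_le hNn)
      linarith
    have := hU n (fun i => a + i * ((b - a) / n)) (fun i => a + i * ((b - a) / n)) (by simp)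
      (by field_simp; ring) (fun i _ => ⟨le_rfl, by push_cast; linarith, by push_cast; linarith⟩)
    have e : ∀ i : ℕ, a + ((i + 1 : ℕ) : ℝ) * ((b - a) / n) - (a + i * ((b - a) / n)) =
        (b - a) / n := fun i => by push_cast; ring
    simp only [e] at this
    exact this
  refine ((Λ.continuous.tendsto y).comp hsum).congr fun n => ?_
  simp [map_sum]

theorem HasWeakIntegral.congr {g' : ℝ → Y} (h : HasWeakIntegral g a b y)
    (hg : ∀ s ∈ uIcc a b, g s = g' s) : HasWeakIntegral g' a b y := fun Λ => by
  rw [← h Λ]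
  exact intervalIntegral.integral_congr fun s hs => by simp only [hg s hs]

theorem HasWeakIntegral.add [IsTopologicalAddGroup Y] {g' : ℝ → Y} (h : HasWeakIntegral g a b y)
    (h' : HasWeakIntegral g' a b z) (hg : Continuous g) (hg' : Continuous g') :
    HasWeakIntegral (fun s => g s + g' s) a b (y + z) := fun Λ => by
  simp only [map_add]
  rw [intervalIntegral.integral_add (f := fun s => Λ (g s)) (g := fun s => Λ (g' s))
    ((Λ.continuous.comp hg).intervalIntegrable _ _)
    ((Λ.continuous.comp hg').intervalIntegrable _ _), h Λ, h' Λ]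

theorem HasWeakIntegral.sub [IsTopologicalAddGroup Y] {g' : ℝ → Y} (h : HasWeakIntegral g a b y)
    (h' : HasWeakIntegral g' a b z) (hg : Continuous g) (hg' : Continuous g') :
    HasWeakIntegral (fun s => g s - g' s) a b (y - z) := fun Λ => by
  simp only [map_sub]
  rw [intervalIntegral.integral_sub (f := fun s => Λ (g s)) (g := fun s => Λ (g' s))
    ((Λ.continuous.comp hg).intervalIntegrable _ _)
    ((Λ.continuous.comp hg').intervalIntegrable _ _), h Λ, h' Λ]

theorem HasWeakIntegral.map {E : Type*} [AddCommGroup E] [Module ℝ E] [TopologicalSpace E]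
    (h : HasWeakIntegral g a b y) (L : Y →L[ℝ] E) :
    HasWeakIntegral (fun s => L (g s)) a b (L y) :=
  fun Λ => h (Λ.comp L)

end Topological

section LocallyConvex

variable [UniformSpace Y] [IsUniformAddGroup Y] [ContinuousSMul ℝ Y] [LocallyConvexSpace ℝ Y]
  {g : ℝ → Y} {a b : ℝ} {y z : Y}

theorem HasWeakIntegral.unique [T2Space Y] (h : HasWeakIntegral g a b y)
    (h' : HasWeakIntegral g a b z) : y = z :=
  eq_of_forall_dual fun Λ => (h Λ).symm.trans (h' Λ)

theorem HasWeakIntegral.seminorm_le (h : HasWeakIntegral g a b y) (hab : a ≤ b)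
    {p : Seminorm ℝ Y} (hp : Continuous p) {M : ℝ} (hM : ∀ s ∈ Icc a b, p (g s) ≤ M) :
    p y ≤ (b - a) * M := by
  obtain ⟨Λ, hΛ, hy⟩ := exists_dual_eq_seminorm hp y
  rw [← hy, ← h Λ]
  refine (le_abs_self _).trans ?_
  rw [← Real.norm_eq_abs]
  refine (intervalIntegral.norm_integral_le_of_norm_le_const (C := M) fun s hs => ?_).trans_eq ?_
  · rw [uIoc_of_le hab] at hs
    exact (hΛ _).trans (hM s ⟨hs.1.le, hs.2⟩)
  · rw [abs_of_nonneg (sub_nonneg.2 hab), mul_comm]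

theorem ContinuousOn.exists_seminorm_modulus {E : Type*} [AddCommGroup E] [Module ℝ E]
    [UniformSpace E] [IsUniformAddGroup E] {g : ℝ → E} {S : Set ℝ} (hg : ContinuousOn g S)
    (hS : IsCompact S) {p : Seminorm ℝ E} (hp : Continuous p) {ε : ℝ} (hε : 0 < ε) :
    ∃ δ > 0, ∀ s ∈ S, ∀ r ∈ S, |s - r| ≤ δ → p (g s - g r) < ε := by
  have hu := hS.uniformContinuousOn_of_continuous hg
  have hV : {q : E × E | p (q.2 - q.1) < ε} ∈ uniformity E := by
    rw [uniformity_eq_comap_nhds_zero]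
    refine ⟨{w | p w < ε}, ?_, fun q hq => hq⟩
    exact (hp.tendsto' 0 0 (map_zero _)).eventually (gt_mem_nhds hε)
  have := hu hV
  rw [mem_map, mem_inf_principal, Metric.mem_uniformity_dist] at this
  obtain ⟨δ, hδ, h⟩ := this
  refine ⟨δ / 2, half_pos hδ, fun s hs r hr hsr => ?_⟩
  refine h (a := r) (b := s) ?_ ⟨hr, hs⟩
  rw [dist_comm, Real.dist_eq]
  linarith

theorem exists_hasWeakIntegral (hY : SeqComplete Y) (hab : a ≤ b)
    (hg : ContinuousOn g (Icc a b)) : ∃ y, HasWeakIntegral g a b y := by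
  set R : ℕ → Y := fun n => ∑ i ∈ Finset.range n, ((b - a) / n) • g (a + i * ((b - a) / n))
    with hR
  have hΛR : ∀ (Λ : Y →L[ℝ] ℝ) n, Λ (R n) =
      ∑ i ∈ Finset.range n, (b - a) / n * Λ (g (a + i * ((b - a) / n))) := fun Λ n => by
    simp [hR, map_sum]
  have hcauchy : CauchySeq R := by
    refine (PolynormableSpace.withSeminorms ℝ Y).cauchySeq fun p ε hε => ?_
    have hc : 0 < ε / (2 * (b - a + 1)) := div_pos hε (by linarith)
    obtain ⟨δ, hδ, hδg⟩ := hg.exists_seminorm_modulus isCompact_Icc p.2 hc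
    obtain ⟨N, hN⟩ := exists_nat_ge ((b - a) / δ)
    have hmesh : ∀ n ≥ N + 1, 0 < n ∧ (b - a) / n ≤ δ := fun n hn => by
      have hn0 : (0 : ℝ) < n := by exact_mod_cast (by omega : 0 < n)
      have hNn : (N : ℝ) ≤ n := by exact_mod_cast (by omega : N ≤ n)
      refine ⟨by omega, ?_⟩
      rw [div_le_iff₀ hn0]
      have := (div_le_iff₀ hδ).1 (hN.trans hNn)
      linarith
    refine ⟨N + 1, fun m hm n hn => ?_⟩
    obtain ⟨Λ, hΛ, hy⟩ := exists_dual_eq_seminorm p.2 (R m - R n)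
    have happrox : ∀ n ≥ N + 1, |Λ (R n) - ∫ s in a..b, Λ (g s)| ≤
        (b - a) * (ε / (2 * (b - a + 1))) := fun n hn => by
      rw [hΛR]
      refine abs_riemannSum_sub_integral_le hab (Λ.continuous.comp_continuousOn hg)
        (fun s hs r hr hsr => ?_) (hmesh n hn).1 (hmesh n hn).2
      rw [Function.comp_apply, Function.comp_apply, ← map_sub]
      exact (hΛ _).trans (hδg s hs r hr hsr).le
    have h1 := abs_le.1 (happrox m hm)
    have h2 := abs_le.1 (happrox n hn)
    have h3 : 2 * ((b - a) * (ε / (2 * (b - a + 1)))) < ε := by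
      have : 0 < b - a + 1 := by linarith
      rw [show 2 * ((b - a) * (ε / (2 * (b - a + 1)))) = (b - a) * ε / (b - a + 1) by field_simp,
        div_lt_iff₀ this]
      nlinarith
    change p.1 (R m - R n) < ε
    rw [← hy, map_sub]
    linarith [h1.2, h2.1]
  obtain ⟨y, hy⟩ := hY R hcauchy
  refine ⟨y, fun Λ => tendsto_nhds_unique
    (tendsto_riemannSum hab (Λ.continuous.comp_continuousOn hg)) ?_⟩
  exact ((Λ.continuous.tendsto y).comp hy).congr fun n => hΛR Λ n

/-- If the integrands `k h` are close to `y` on the whole of `[0, h]`, then their averages over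
`[0, h]` tend to `y`. -/
theorem tendsto_inv_smul_of_forall_near {k : ℝ → ℝ → Y} {G : ℝ → Y}
    (hc : ∀ᶠ h in 𝓝[>] 0, ContinuousOn (k h) (Icc 0 h))
    (hG : ∀ᶠ h in 𝓝[>] 0, HasWeakIntegral (k h) 0 h (G h))
    (hk : ∀ p : Seminorm ℝ Y, Continuous p → ∀ ε > 0,
      ∀ᶠ h in 𝓝[>] 0, ∀ s ∈ Icc 0 h, p (k h s - y) ≤ ε) :
    Tendsto (fun h : ℝ => h⁻¹ • G h) (𝓝[>] 0) (𝓝 y) := by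
  rw [tendsto_nhds_iff_seminorm]
  intro p hp ε hε
  filter_upwards [hc, hG, hk p hp _ (half_pos hε), self_mem_nhdsWithin] with h hc hG hk hh
  have hh0 : 0 < h := hh
  have hw : HasWeakIntegral (fun s => k h s - y) 0 h (G h - h • y) := fun Λ => by
    have hint : IntervalIntegrable (fun s => Λ (k h s)) volume 0 h := by
      refine ContinuousOn.intervalIntegrable (Λ.continuous.comp_continuousOn ?_)
      rwa [uIcc_of_le hh0.le]
    simp only [map_sub]
    rw [intervalIntegral.integral_sub hint (by simp), hG Λ]
    simp
  have hle := hw.seminorm_le hh0.le hp hk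
  have e : h⁻¹ • G h - y = h⁻¹ • (G h - h • y) := by
    rw [smul_sub, smul_smul, inv_mul_cancel₀ hh0.ne', one_smul]
  rw [e, map_smul_eq_mul, Real.norm_eq_abs, abs_of_pos (inv_pos.2 hh0)]
  calc h⁻¹ * p (G h - h • y) ≤ h⁻¹ * ((h - 0) * (ε / 2)) :=
        mul_le_mul_of_nonneg_left hle (inv_pos.2 hh0).le
    _ = ε / 2 := by field_simp; ring
    _ < ε := half_lt_self hε

/-- The fundamental theorem of calculus at the left end point. -/
theorem tendsto_inv_smul_of_hasWeakIntegral {G : ℝ → Y} {δ : ℝ} (hδ : 0 < δ)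
    (hg : ContinuousOn g (Icc 0 δ)) (hG : ∀ h ∈ Ioc 0 δ, HasWeakIntegral g 0 h (G h)) :
    Tendsto (fun h : ℝ => h⁻¹ • G h) (𝓝[>] 0) (𝓝 (g 0)) := by
  have hI : ∀ᶠ h in 𝓝[>] (0 : ℝ), h ∈ Ioc 0 δ := Ioc_mem_nhdsGT hδ
  refine tendsto_inv_smul_of_forall_near (k := fun _ => g)
    (hI.mono fun h hh => hg.mono (Icc_subset_Icc_right hh.2)) (hI.mono hG) fun p hp ε hε => ?_
  have hlim : ∀ᶠ s in 𝓝[Icc 0 δ] (0 : ℝ), p (g s - g 0) < ε :=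
    tendsto_nhds_iff_seminorm.1 (hg 0 ⟨le_rfl, hδ.le⟩) p hp _ hε
  rw [nhdsWithin_Icc_eq_nhdsGE hδ] at hlim
  obtain ⟨η, hη, hηs⟩ := mem_nhdsGE_iff_exists_Ico_subset.1 hlim
  filter_upwards [Ioo_mem_nhdsGT (mem_Ioi.1 hη)] with h hh s hs
  exact le_of_lt (hηs ⟨hs.1, hs.2.trans_lt hh.2⟩)

/-- The average over `[0, h]` of a convolution integrand `s ↦ k (h - s, s)` tends to
`k (0, 0)`. -/
theorem tendsto_inv_smul_of_hasWeakIntegral_kernel {k : ℝ × ℝ → Y} (hk : Continuous k) {G : ℝ → Y}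
    {δ : ℝ} (hδ : 0 < δ) (hG : ∀ h ∈ Ioc 0 δ, HasWeakIntegral (fun s => k (h - s, s)) 0 h (G h)) :
    Tendsto (fun h : ℝ => h⁻¹ • G h) (𝓝[>] 0) (𝓝 (k (0, 0))) := by
  have hI : ∀ᶠ h in 𝓝[>] (0 : ℝ), h ∈ Ioc 0 δ := Ioc_mem_nhdsGT hδ
  refine tendsto_inv_smul_of_forall_near (Eventually.of_forall fun h => ?_) (hI.mono hG)
    fun p hp ε hε => ?_
  · exact (hk.comp (by fun_prop : Continuous fun s : ℝ => (h - s, s))).continuousOn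
  · have hnear : ∀ᶠ q : ℝ × ℝ in 𝓝 (0, 0), p (k q - k (0, 0)) < ε :=
      tendsto_nhds_iff_seminorm.1 (hk.tendsto (0, 0)) p hp _ hε
    obtain ⟨η, hη, hball⟩ := Metric.eventually_nhds_iff_ball.1 hnear
    filter_upwards [Ioo_mem_nhdsGT hη] with h hh s hs
    refine (hball (h - s, s) ?_).le
    rw [Metric.mem_ball, Prod.dist_eq, Real.dist_eq, Real.dist_eq, sub_zero, sub_zero,
      abs_of_nonneg (sub_nonneg.2 hs.2), abs_of_nonneg hs.1]
    exact max_lt (by linarith [hs.1, hh.2]) (by linarith [hs.2, hh.2])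

end LocallyConvex

end WeakIntegral

/-! ### Orbits of locally equicontinuous semigroups -/

theorem NNReal.tendsto_coe_nhdsGT_zero :
    Tendsto ((↑) : ℝ≥0 → ℝ) (𝓝[>] 0) (𝓝[>] 0) :=
  tendsto_nhdsWithin_iff.2 ⟨(NNReal.continuous_coe.tendsto' 0 0 rfl).mono_left nhdsWithin_le_nhds,
    eventually_nhdsWithin_of_forall fun _ ht => NNReal.coe_pos.2 ht⟩

theorem Real.tendsto_toNNReal_sub_nhdsGT (s : ℝ) :
    Tendsto (fun r : ℝ => (r - s).toNNReal) (𝓝[>] s) (𝓝[>] 0) :=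
  tendsto_nhdsWithin_iff.2 ⟨((by fun_prop : Continuous fun r : ℝ => (r - s).toNNReal).tendsto' s 0
    (by simp)).mono_left nhdsWithin_le_nhds,
    eventually_nhdsWithin_of_forall fun _ hr => Real.toNNReal_pos.2 (sub_pos.2 hr)⟩

namespace IsLocallyEquicontinuousC0Semigroup

variable {𝕜 Y : Type*} [RCLike 𝕜] [AddCommGroup Y] [Module 𝕜 Y] [UniformSpace Y]
  {T : ℝ≥0 → Y →L[𝕜] Y}

theorem continuous_orbit_real (hT : IsLocallyEquicontinuousC0Semigroup T) (y : Y) :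
    Continuous fun s : ℝ => T s.toNNReal y :=
  (hT.continuous_orbit y).comp continuous_real_toNNReal

theorem map_add_apply (hT : IsLocallyEquicontinuousC0Semigroup T) (t s : ℝ≥0) (y : Y) :
    T (t + s) y = T t (T s y) := by
  rw [hT.map_add]; rfl

theorem map_toNNReal_add (hT : IsLocallyEquicontinuousC0Semigroup T) {t s : ℝ} (ht : 0 ≤ t)
    (hs : 0 ≤ s) (y : Y) :
    T (t + s).toNNReal y = T t.toNNReal (T s.toNNReal y) := by
  rw [Real.toNNReal_add ht hs, hT.map_add_apply]

variable [Module ℝ Y] [IsScalarTower ℝ 𝕜 Y]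

/-- The orbit of a vector in the domain of the generator is an antiderivative. -/
theorem hasWeakIntegral_orbit (hT : IsLocallyEquicontinuousC0Semigroup T) {x y : Y}
    (h : Tendsto (fun h : ℝ≥0 => (h : ℝ)⁻¹ • (T h x - x)) (𝓝[>] 0) (𝓝 y)) {t : ℝ} (ht : 0 ≤ t) :
    HasWeakIntegral (fun s => T s.toNNReal y) 0 t (T t.toNNReal x - x) := by
  intro Λ
  have hφ : ∀ z, Continuous fun s : ℝ => Λ (T s.toNNReal z) :=
    fun z => Λ.continuous.comp (hT.continuous_orbit_real z)
  have := intervalIntegral.integral_eq_sub_of_hasDeriv_right (a := 0) (b := t)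
    (f := fun s : ℝ => Λ (T s.toNNReal x)) (f' := fun s : ℝ => Λ (T s.toNNReal y))
    (hφ x).continuousOn (fun s hs => ?_) ((hφ y).intervalIntegrable _ _)
  · rw [this]
    simp [hT.map_zero]
  · rw [min_eq_left ht] at hs
    rw [hasDerivWithinAt_iff_tendsto_slope' (by simp)]
    have hlim := ((Λ.comp ((T s.toNNReal).restrictScalars ℝ)).continuous.tendsto y).comp
      (h.comp (Real.tendsto_toNNReal_sub_nhdsGT s))
    refine hlim.congr' (eventually_nhdsWithin_of_forall fun r hr => ?_)
    have hsr : 0 < r - s := sub_pos.2 hr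
    have e : T r.toNNReal x = T s.toNNReal (T (r - s).toNNReal x) := by
      rw [← hT.map_toNNReal_add hs.1.le hsr.le, add_sub_cancel]
    simp only [Function.comp_apply, slope_def_module, ContinuousLinearMap.comp_apply, map_smul,
      Real.coe_toNNReal _ hsr.le, ContinuousLinearMap.coe_restrictScalars', e, map_sub]

variable [IsUniformAddGroup Y] [LocallyConvexSpace ℝ Y]

theorem exists_seminorm_bound_rclike [ContinuousSMul 𝕜 Y]
    (hT : IsLocallyEquicontinuousC0Semigroup T) (t₁ : ℝ≥0) {p : Seminorm 𝕜 Y} (hp : Continuous p) :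
    ∃ q : Seminorm 𝕜 Y, Continuous q ∧ ∀ t ≤ t₁, ∀ y, p (T t y) ≤ q y := by
  have := polynormableSpace_of_locallyConvexSpace_real 𝕜 Y
  have h := ((PolynormableSpace.withSeminorms 𝕜 Y).equicontinuous_TFAE
    (fun t : Icc 0 t₁ => (T t : Y →ₗ[𝕜] Y))).out 1 3
  obtain ⟨q, hq, hle⟩ := h.1 (hT.locally_equicontinuous t₁) ⟨p, hp⟩
  exact ⟨q, hq, fun t ht y => hle ⟨t, zero_le, ht⟩ y⟩

variable [ContinuousSMul ℝ Y]

theorem exists_seminorm_bound (hT : IsLocallyEquicontinuousC0Semigroup T) (t₁ : ℝ≥0)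
    {p : Seminorm ℝ Y} (hp : Continuous p) :
    ∃ q : Seminorm ℝ Y, Continuous q ∧ ∀ t ≤ t₁, ∀ y, p (T t y) ≤ q y := by
  have h := ((PolynormableSpace.withSeminorms ℝ Y).equicontinuous_TFAE
    (fun t : Icc 0 t₁ => ((T t).restrictScalars ℝ : Y →ₗ[ℝ] Y))).out 1 3
  obtain ⟨q, hq, hle⟩ := h.1 (hT.locally_equicontinuous t₁) ⟨p, hp⟩
  exact ⟨q, hq, fun t ht y => hle ⟨t, zero_le, ht⟩ y⟩

theorem continuous_uncurry (hT : IsLocallyEquicontinuousC0Semigroup T) :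
    Continuous fun q : ℝ≥0 × Y => T q.1 q.2 := by
  rw [continuous_iff_continuousAt]
  rintro ⟨t, y⟩
  refine tendsto_nhds_iff_seminorm.2 fun p hp ε hε => ?_
  obtain ⟨q, hq, hle⟩ := hT.exists_seminorm_bound (t + 1) hp
  have h1 : ∀ᶠ z in 𝓝 y, q (z - y) < ε / 2 :=
    tendsto_nhds_iff_seminorm.1 tendsto_id q hq _ (half_pos hε)
  have h2 : ∀ᶠ s in 𝓝 t, p (T s y - T t y) < ε / 2 :=
    tendsto_nhds_iff_seminorm.1 ((hT.continuous_orbit y).tendsto t) p hp _ (half_pos hε)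
  have h3 : ∀ᶠ s in 𝓝 t, s < t + 1 := gt_mem_nhds (lt_add_one t)
  filter_upwards [(h2.and h3).prod_nhds h1] with z hz
  have e : T z.1 z.2 - T t y = T z.1 (z.2 - y) + (T z.1 y - T t y) := by
    rw [map_sub]; abel
  rw [e]
  refine (map_add_le_add p _ _).trans_lt ?_
  linarith [hle z.1 hz.1.2.le (z.2 - y), hz.1.1, hz.2]

/-- Integrals of orbits lie in the domain of the generator. -/
theorem tendsto_of_hasWeakIntegral_orbit (hT : IsLocallyEquicontinuousC0Semigroup T) {y w : Y}
    {t : ℝ} (ht : 0 ≤ t) (hw : HasWeakIntegral (fun s => T s.toNNReal y) 0 t w) :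
    Tendsto (fun h : ℝ≥0 => (h : ℝ)⁻¹ • (T h w - w)) (𝓝[>] 0) (𝓝 (T t.toNNReal y - y)) := by
  have hc := hT.continuous_orbit_real y
  have hct : Continuous fun s : ℝ => T (s + t).toNNReal y :=
    hc.comp (by fun_prop : Continuous fun s : ℝ => s + t)
  have hg : Continuous fun s : ℝ => T (s + t).toNNReal y - T s.toNNReal y := hct.sub hc
  have key : ∀ h ∈ Ioc (0 : ℝ) 1, HasWeakIntegral
      (fun s : ℝ => T (s + t).toNNReal y - T s.toNNReal y) 0 h (T h.toNNReal w - w) := by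
    intro h hh Λ
    have hφ : Continuous fun s : ℝ => Λ (T s.toNNReal y) := Λ.continuous.comp hc
    have h1 : ∫ s in (0 : ℝ)..t, Λ (T (s + h).toNNReal y) = Λ (T h.toNNReal w) := by
      have := (hw.map ((T h.toNNReal).restrictScalars ℝ)) Λ
      rw [ContinuousLinearMap.coe_restrictScalars'] at this
      rw [← this]
      refine intervalIntegral.integral_congr fun s hs => ?_
      rw [uIcc_of_le ht] at hs
      simp only
      rw [add_comm s h, hT.map_toNNReal_add hh.1.le hs.1]
    simp only [map_sub]
    rw [intervalIntegral.integral_sub (f := fun s => Λ (T (s + t).toNNReal y))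
        ((Λ.continuous.comp hct).intervalIntegrable _ _) (hφ.intervalIntegrable _ _),
      intervalIntegral.integral_comp_add_right (fun s => Λ (T s.toNNReal y)), ← h1, ← hw Λ,
      intervalIntegral.integral_comp_add_right (fun s => Λ (T s.toNNReal y)), zero_add, zero_add,
      add_comm t h]
    have i1 := intervalIntegral.integral_add_adjacent_intervals
      (hφ.intervalIntegrable (μ := MeasureTheory.volume) 0 t) (hφ.intervalIntegrable t (h + t))
    have i2 := intervalIntegral.integral_add_adjacent_intervals
      (hφ.intervalIntegrable (μ := MeasureTheory.volume) 0 h) (hφ.intervalIntegrable h (h + t))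
    linarith
  have := (tendsto_inv_smul_of_hasWeakIntegral one_pos hg.continuousOn key).comp
    NNReal.tendsto_coe_nhdsGT_zero
  simpa [Function.comp_def, hT.map_zero] using this

end IsLocallyEquicontinuousC0Semigroup

/-! ### The Volterra operator -/

section Volterra

set_option linter.unusedSectionVars false

open MeasureTheory

variable {𝕜 X Xbar : Type*} [RCLike 𝕜]
  [AddCommGroup X] [Module 𝕜 X] [Module ℝ X] [IsScalarTower ℝ 𝕜 X] [UniformSpace X]
  [AddCommGroup Xbar] [Module 𝕜 Xbar] [Module ℝ Xbar] [IsScalarTower ℝ 𝕜 Xbar]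
  [UniformSpace Xbar]

/-- `v` is the value at `t` of the Volterra operator applied to `f`: `v` is the element of `X`
representing the integral `∫₀ᵗ Tbar (t - s) (B (f s)) ds` of `Xbar`. -/
def IsVolterra (Tbar : ℝ≥0 → Xbar →L[𝕜] Xbar) (ι B : X →L[𝕜] Xbar) (f : ℝ → X) (t : ℝ) (v : X) :
    Prop :=
  HasWeakIntegral (fun s => Tbar (t - s).toNNReal (B (f s))) 0 t (ι v)

/-- The Volterra operator at time `t₀` is bounded by `K` for the seminorm `p`. -/
def VolterraBound (Tbar : ℝ≥0 → Xbar →L[𝕜] Xbar) (ι B : X →L[𝕜] Xbar) (t₀ : ℝ)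
    (p : Seminorm 𝕜 X) (K : ℝ) : Prop :=
  ∀ f : ℝ → X, Continuous f → ∀ x, IsVolterra Tbar ι B f t₀ x →
    ∀ M : ℝ, (∀ s ∈ Icc 0 t₀, p (f s) ≤ M) → p x ≤ K * M

/-- The hypotheses on a perturbation `B` in terms of weak integrals. The domain condition on the
generator of `Tbar` enters only through `orbit_integral_mem`. -/
structure IsAdmissiblePerturbation (Γ : Set (Seminorm 𝕜 X)) (T : ℝ≥0 → X →L[𝕜] X)
    (Tbar : ℝ≥0 → Xbar →L[𝕜] Xbar) (ι B : X →L[𝕜] Xbar) (t₀ : ℝ) : Prop where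
  seqComplete : SeqComplete X
  fundamental : IsFundamentalSystem Γ
  semigroup : IsLocallyEquicontinuousC0Semigroup T
  semigroup_ext : IsLocallyEquicontinuousC0Semigroup Tbar
  injective : Function.Injective ι
  ext_apply : ∀ (t : ℝ≥0) (x : X), Tbar t (ι x) = ι (T t x)
  pos : 0 < t₀
  orbit_integral_mem : ∀ (y : Xbar) (t : ℝ), 0 ≤ t →
    ∃ x, HasWeakIntegral (fun s => Tbar s.toNNReal y) 0 t (ι x)
  volterra_mem : ∀ f : ℝ → X, Continuous f → ∃ x, IsVolterra Tbar ι B f t₀ x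
  volterra_bound : ∀ p ∈ Γ, ∃ K : ℝ, 0 < K ∧ K < 1 ∧ VolterraBound Tbar ι B t₀ p K

namespace IsVolterra

variable {Tbar : ℝ≥0 → Xbar →L[𝕜] Xbar} {ι B : X →L[𝕜] Xbar} {f g : ℝ → X} {t s : ℝ} {v w : X}

theorem congr (h : IsVolterra Tbar ι B f t v) (ht : 0 ≤ t) (hfg : ∀ s ∈ Icc 0 t, f s = g s) :
    IsVolterra Tbar ι B g t v :=
  HasWeakIntegral.congr h fun s hs => by
    rw [uIcc_of_le ht] at hs
    simp only [hfg s hs]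

theorem zero_of_eq (ht : 0 ≤ t) (hf : ∀ s ∈ Icc 0 t, f s = 0) : IsVolterra Tbar ι B f t 0 := by
  refine congr (f := fun _ => 0) (fun Λ => ?_) ht fun s hs => (hf s hs).symm
  simp

theorem at_zero : IsVolterra Tbar ι B f 0 0 := fun Λ => by simp

theorem smul [ContinuousConstSMul 𝕜 Xbar] (h : IsVolterra Tbar ι B f t v) (c : 𝕜) :
    IsVolterra Tbar ι B (fun s => c • f s) t (c • v) := by
  have := HasWeakIntegral.map h ((c • ContinuousLinearMap.id 𝕜 Xbar).restrictScalars ℝ)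
  simpa [IsVolterra] using this

end IsVolterra

namespace IsAdmissiblePerturbation

variable [IsUniformAddGroup X] [ContinuousSMul 𝕜 X] [ContinuousSMul ℝ X] [LocallyConvexSpace ℝ X]
  [T2Space X]
  [IsUniformAddGroup Xbar] [ContinuousSMul 𝕜 Xbar] [ContinuousSMul ℝ Xbar]
  [LocallyConvexSpace ℝ Xbar] [T2Space Xbar]
  {Γ : Set (Seminorm 𝕜 X)} {T : ℝ≥0 → X →L[𝕜] X} {Tbar : ℝ≥0 → Xbar →L[𝕜] Xbar}
  {ι B : X →L[𝕜] Xbar} {t₀ : ℝ} {f g : ℝ → X} {t s : ℝ} {v w x : X}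

theorem withSeminorms (h : IsAdmissiblePerturbation Γ T Tbar ι B t₀) :
    WithSeminorms (fun p : Γ => (p : Seminorm 𝕜 X)) :=
  have := polynormableSpace_of_locallyConvexSpace_real 𝕜 X
  h.fundamental.withSeminorms

theorem continuous_kernel (h : IsAdmissiblePerturbation Γ T Tbar ι B t₀) (hf : Continuous f) :
    Continuous fun q : ℝ × ℝ => Tbar q.1.toNNReal (B (f q.2)) :=
  h.semigroup_ext.continuous_uncurry.comp
    ((continuous_real_toNNReal.comp continuous_fst).prodMk
      (B.continuous.comp (hf.comp continuous_snd)))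

theorem continuous_integrand (h : IsAdmissiblePerturbation Γ T Tbar ι B t₀) (hf : Continuous f)
    (t : ℝ) : Continuous fun s : ℝ => Tbar (t - s).toNNReal (B (f s)) :=
  (h.continuous_kernel hf).comp (by fun_prop : Continuous fun s : ℝ => (t - s, s))

theorem unique (h : IsAdmissiblePerturbation Γ T Tbar ι B t₀) (hv : IsVolterra Tbar ι B f t v)
    (hw : IsVolterra Tbar ι B f t w) : v = w :=
  h.injective (HasWeakIntegral.unique hv hw)

theorem isVolterra_add (h : IsAdmissiblePerturbation Γ T Tbar ι B t₀) (hf : Continuous f)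
    (hg : Continuous g) (hv : IsVolterra Tbar ι B f t v) (hw : IsVolterra Tbar ι B g t w) :
    IsVolterra Tbar ι B (fun s => f s + g s) t (v + w) := by
  have := HasWeakIntegral.add hv hw (h.continuous_integrand hf t) (h.continuous_integrand hg t)
  simpa [IsVolterra] using this

theorem isVolterra_sub (h : IsAdmissiblePerturbation Γ T Tbar ι B t₀) (hf : Continuous f)
    (hg : Continuous g) (hv : IsVolterra Tbar ι B f t v) (hw : IsVolterra Tbar ι B g t w) :
    IsVolterra Tbar ι B (fun s => f s - g s) t (v - w) := by
  have := h.isVolterra_add hf (hg.const_smul (-1 : 𝕜)) hv (hw.smul (-1 : 𝕜))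
  simpa [sub_eq_add_neg] using this

/-- The cocycle identity of the Volterra operator: restarting at time `s`. -/
theorem isVolterra_shift_iff (h : IsAdmissiblePerturbation Γ T Tbar ι B t₀) (hf : Continuous f)
    (hs : 0 ≤ s) (ht : 0 ≤ t) (hv : IsVolterra Tbar ι B f s v) :
    IsVolterra Tbar ι B (fun r => f (r + s)) t w ↔
      IsVolterra Tbar ι B f (t + s) (T t.toNNReal v + w) := by
  refine forall_congr' fun Λ => ?_
  set φ : ℝ → ℝ := fun r => Λ (Tbar (t + s - r).toNNReal (B (f r))) with hφ
  have hφc : Continuous φ := Λ.continuous.comp (h.continuous_integrand hf (t + s))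
  have h1 : ∫ r in (0 : ℝ)..s, φ r = Λ (ι (T t.toNNReal v)) := by
    have := (HasWeakIntegral.map hv ((Tbar t.toNNReal).restrictScalars ℝ)) Λ
    rw [ContinuousLinearMap.coe_restrictScalars', h.ext_apply] at this
    rw [← this]
    refine intervalIntegral.integral_congr fun r hr => ?_
    rw [uIcc_of_le hs] at hr
    simp only [hφ]
    rw [← h.semigroup_ext.map_toNNReal_add ht (sub_nonneg.2 hr.2), add_sub_assoc]
  have h2 : ∫ r in s..(t + s), φ r =
      ∫ r in (0 : ℝ)..t, Λ (Tbar (t - r).toNNReal (B (f (r + s)))) := by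
    have := intervalIntegral.integral_comp_add_right φ s (a := 0) (b := t)
    rw [zero_add] at this
    rw [← this]
    simp only [hφ, add_sub_add_right_eq_sub]
  have h3 := intervalIntegral.integral_add_adjacent_intervals
    (hφc.intervalIntegrable (μ := volume) 0 s) (hφc.intervalIntegrable s (t + s))
  rw [← h2, map_add, map_add, ← h3, h1, add_right_inj]

theorem isVolterra_shift (h : IsAdmissiblePerturbation Γ T Tbar ι B t₀) (hf : Continuous f)
    (hs : 0 ≤ s) (ht : 0 ≤ t) (hv : IsVolterra Tbar ι B f s v)
    (hw : IsVolterra Tbar ι B (fun r => f (r + s)) t w) :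
    IsVolterra Tbar ι B f (t + s) (T t.toNNReal v + w) :=
  (h.isVolterra_shift_iff hf hs ht hv).1 hw

/-- A function vanishing at `0` can be delayed, so that its Volterra integrals at earlier times
become integrals over the whole of `[0, t₀]`. -/
theorem isVolterra_delay_iff (h : IsAdmissiblePerturbation Γ T Tbar ι B t₀) (hf : Continuous f)
    (hf0 : f 0 = 0) (ht : t ∈ Icc 0 t₀) :
    IsVolterra Tbar ι B f t v ↔
      IsVolterra Tbar ι B (fun s => f (max 0 (s - (t₀ - t)))) t₀ v := by
  have hc : Continuous fun s => f (max 0 (s - (t₀ - t))) := hf.comp (by fun_prop)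
  have hz : IsVolterra Tbar ι B (fun s => f (max 0 (s - (t₀ - t)))) (t₀ - t) 0 :=
    IsVolterra.zero_of_eq (sub_nonneg.2 ht.2) fun s hs => by
      rw [max_eq_left (by linarith [hs.2]), hf0]
  have key := h.isVolterra_shift_iff (w := v) hc (sub_nonneg.2 ht.2) ht.1 hz
  rw [add_sub_cancel, map_zero, zero_add] at key
  rw [← key]
  have e : ∀ s ∈ Icc 0 t, f s = f (max 0 (s + (t₀ - t) - (t₀ - t))) := fun s hs => by
    rw [add_sub_cancel_right, max_eq_right hs.1]
  exact ⟨fun hv => hv.congr ht.1 e, fun hv => hv.congr ht.1 fun s hs => (e s hs).symm⟩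

theorem seminorm_le_of_zero (h : IsAdmissiblePerturbation Γ T Tbar ι B t₀)
    {p : Seminorm 𝕜 X} {K : ℝ} (hK : VolterraBound Tbar ι B t₀ p K)
    (hf : Continuous f) (hf0 : f 0 = 0) (ht : t ∈ Icc 0 t₀) (hv : IsVolterra Tbar ι B f t v)
    {M : ℝ} (hM : ∀ s ∈ Icc 0 t, p (f s) ≤ M) : p v ≤ K * M := by
  refine hK _ (hf.comp (by fun_prop)) v ((h.isVolterra_delay_iff hf hf0 ht).1 hv) M fun s hs => ?_
  exact hM _ ⟨le_max_left _ _, max_le ht.1 (by linarith [hs.2])⟩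

theorem exists_isVolterra_const (h : IsAdmissiblePerturbation Γ T Tbar ι B t₀) (x : X)
    (ht : 0 ≤ t) : ∃ v, IsVolterra Tbar ι B (fun _ => x) t v := by
  obtain ⟨v, hv⟩ := h.orbit_integral_mem (B x) t ht
  refine ⟨v, fun Λ => ?_⟩
  rw [← hv Λ, intervalIntegral.integral_comp_sub_left (fun s => Λ (Tbar s.toNNReal (B x)))]
  simp

theorem exists_isVolterra (h : IsAdmissiblePerturbation Γ T Tbar ι B t₀) (hf : Continuous f)
    (ht : t ∈ Icc 0 t₀) : ∃ v, IsVolterra Tbar ι B f t v := by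
  have hf' : Continuous fun s => f s - f 0 := hf.sub continuous_const
  obtain ⟨v, hv⟩ := h.volterra_mem (fun s => f (max 0 (s - (t₀ - t))) - f 0)
    (hf'.comp (by fun_prop : Continuous fun s : ℝ => max 0 (s - (t₀ - t))))
  have hv := (h.isVolterra_delay_iff (f := fun s => f s - f 0) hf' (sub_self _) ht).2 hv
  obtain ⟨w, hw⟩ := h.exists_isVolterra_const (f 0) ht.1
  exact ⟨v + w, (h.isVolterra_add hf' continuous_const hv hw).congr ht.1 fun s _ =>
    sub_add_cancel _ _⟩

theorem continuousOn_of_zero (h : IsAdmissiblePerturbation Γ T Tbar ι B t₀) (hf : Continuous f)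
    (hf0 : f 0 = 0) {V : ℝ → X} (hV : ∀ t ∈ Icc 0 t₀, IsVolterra Tbar ι B f t (V t)) :
    ContinuousOn V (Icc 0 t₀) := by
  intro t ht
  refine (h.withSeminorms.tendsto_nhds V _).2 fun p ε hε => ?_
  obtain ⟨K, hK0, hK1, hK⟩ := h.volterra_bound p p.2
  obtain ⟨δ, hδ, hmod⟩ := hf.continuousOn.exists_seminorm_modulus (isCompact_Icc (a := 0) (b := t₀))
    (p := p.1.restrictScalars ℝ) (h.fundamental.1 p p.2) hε
  have hclose : ∀ᶠ r in 𝓝[Icc 0 t₀] t, dist r t < δ :=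
    nhdsWithin_le_nhds (Metric.ball_mem_nhds t hδ)
  filter_upwards [hclose, self_mem_nhdsWithin] with r hr hrI
  have hcr : ∀ r, Continuous fun s => f (max 0 (s - (t₀ - r))) := fun r => hf.comp (by fun_prop)
  have hd := h.isVolterra_sub (hcr r) (hcr t)
    ((h.isVolterra_delay_iff hf hf0 hrI).1 (hV r hrI))
    ((h.isVolterra_delay_iff hf hf0 ht).1 (hV t ht))
  have hle := hK _ ((hcr r).sub (hcr t)) _ hd ε fun s hs => le_of_lt ?_
  · calc p.1 (V r - V t) ≤ K * ε := hle
      _ < ε := by nlinarith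
  · refine hmod _ ⟨le_max_left _ _, max_le h.pos.le (by linarith [hs.2, hrI.2])⟩ _
      ⟨le_max_left _ _, max_le h.pos.le (by linarith [hs.2, ht.2])⟩ ?_
    refine (abs_max_sub_max_le_max _ _ _ _).trans (max_le (by simpa using hδ.le) ?_)
    rw [Real.dist_eq] at hr
    rw [show s - (t₀ - r) - (s - (t₀ - t)) = r - t by ring]
    exact hr.le

/-- The cut-off functions `s ↦ max 0 (1 - s / ε)` isolate the part of the Volterra integrals that
comes from times near `0`. -/
theorem continuous_cutoff (ε : ℝ) (x : X) : Continuous fun s : ℝ => max 0 (1 - s / ε) • x := by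
  fun_prop

theorem isVolterra_cutoff (h : IsAdmissiblePerturbation Γ T Tbar ι B t₀) {ε : ℝ} (hε : 0 < ε)
    (ht : ε ≤ t) (hv : IsVolterra Tbar ι B (fun s => max 0 (1 - s / ε) • x) ε v) :
    IsVolterra Tbar ι B (fun s => max 0 (1 - s / ε) • x) t (T (t - ε).toNNReal v) := by
  have hz : IsVolterra Tbar ι B (fun r => max 0 (1 - (r + ε) / ε) • x) (t - ε) 0 :=
    IsVolterra.zero_of_eq (sub_nonneg.2 ht) fun r hr => by
      have : 1 - (r + ε) / ε ≤ 0 := by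
        rw [add_div, div_self hε.ne']
        linarith [div_nonneg hr.1 hε.le]
      rw [max_eq_left this, zero_smul]
  simpa using h.isVolterra_shift (continuous_cutoff ε x) hε.le (sub_nonneg.2 ht) hv hz

/-- The Volterra integrals of a constant depend continuously on time. Away from `0` the constant
can be replaced by a function vanishing at `0`, at the cost of an orbit of `T`;
the cocycle identity then transports continuity to the time `0`. -/
theorem continuousOn_const (h : IsAdmissiblePerturbation Γ T Tbar ι B t₀) {J : ℝ → X}
    (hJ : ∀ t ∈ Icc 0 t₀, IsVolterra Tbar ι B (fun _ => x) t (J t)) :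
    ContinuousOn J (Icc 0 t₀) := by
  set ε := t₀ / 2 with hεdef
  have hε : 0 < ε := half_pos h.pos
  have hεt : ε ≤ t₀ := half_le_self h.pos.le
  have hg : Continuous fun s : ℝ => x - max 0 (1 - s / ε) • x :=
    continuous_const.sub (continuous_cutoff ε x)
  choose! P hP using fun t (ht : t ∈ Icc 0 t₀) => h.exists_isVolterra hg ht
  have hPc := h.continuousOn_of_zero hg (by simp) hP
  have hJP : ∀ t ∈ Icc 0 t₀,
      IsVolterra Tbar ι B (fun s => max 0 (1 - s / ε) • x) t (J t - P t) := fun t ht =>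
    (h.isVolterra_sub continuous_const hg (hJ t ht) (hP t ht)).congr ht.1 fun s _ => by
      rw [sub_sub_cancel]
  have hlate : ContinuousOn J (Icc ε t₀) := by
    have hc : ContinuousOn (fun t => T (t - ε).toNNReal (J ε - P ε) + P t) (Icc ε t₀) :=
      ((h.semigroup.continuous_orbit_real _).comp
        (by fun_prop : Continuous fun t : ℝ => t - ε)).continuousOn.add
        (hPc.mono (Icc_subset_Icc_left hε.le))
    refine hc.congr fun t ht => ?_
    have := h.unique (hJP t ⟨hε.le.trans ht.1, ht.2⟩)
      (h.isVolterra_cutoff hε ht.1 (hJP ε ⟨hε.le, hεt⟩))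
    simp only
    rw [← this, sub_add_cancel]
  have hearly : ContinuousOn J (Icc 0 ε) := by
    have hc : ContinuousOn (fun t => J (t + ε) - T t.toNNReal (J ε)) (Icc 0 ε) := by
      refine (hlate.comp (by fun_prop : Continuous fun t : ℝ => t + ε).continuousOn ?_).sub
        (h.semigroup.continuous_orbit_real _).continuousOn
      intro t ht
      exact ⟨by linarith [ht.1], by linarith [ht.2]⟩
    refine hc.congr fun t ht => ?_
    have h1 := hJ (t + ε) ⟨by linarith [ht.1], by linarith [ht.2]⟩
    have h2 := h.isVolterra_shift (f := fun _ => x) continuous_const hε.le ht.1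
      (hJ ε ⟨hε.le, hεt⟩) (hJ t ⟨ht.1, ht.2.trans hεt⟩)
    simp only
    rw [h.unique h1 h2, add_sub_cancel_left]
  rw [← Icc_union_Icc_eq_Icc hε.le hεt]
  exact hearly.union_of_isClosed hlate isClosed_Icc isClosed_Icc

theorem continuousOn_volterra (h : IsAdmissiblePerturbation Γ T Tbar ι B t₀) (hf : Continuous f)
    {V : ℝ → X} (hV : ∀ t ∈ Icc 0 t₀, IsVolterra Tbar ι B f t (V t)) :
    ContinuousOn V (Icc 0 t₀) := by
  have hf' : Continuous fun s => f s - f 0 := hf.sub continuous_const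
  choose! J hJ using fun t (ht : t ∈ Icc 0 t₀) => h.exists_isVolterra_const (f 0) ht.1
  have hd := h.continuousOn_of_zero hf' (sub_self _) fun t ht =>
    h.isVolterra_sub hf continuous_const (hV t ht) (hJ t ht)
  refine (hd.add (h.continuousOn_const hJ)).congr fun t _ => ?_
  simp

/-- The Volterra operator commutes with integration in time. -/
theorem isVolterra_of_hasWeakIntegral (h : IsAdmissiblePerturbation Γ T Tbar ι B t₀)
    (hf : Continuous f) (ht : 0 ≤ t) {F V : ℝ → X}
    (hF : ∀ s ∈ Icc 0 t, HasWeakIntegral f 0 s (F s))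
    (hV : ∀ s ∈ Icc 0 t, IsVolterra Tbar ι B f s (V s)) (hw : HasWeakIntegral V 0 t w) :
    IsVolterra Tbar ι B F t w := by
  intro Λ
  have hk : Continuous (Function.uncurry fun a r : ℝ => Λ (Tbar a.toNNReal (B (f r)))) :=
    Λ.continuous.comp (h.continuous_kernel hf)
  have hR : Λ (ι w) = ∫ s in (0 : ℝ)..t, ∫ r in (0 : ℝ)..s,
      Λ (Tbar (s - r).toNNReal (B (f r))) := by
    refine (hw (Λ.comp (ι.restrictScalars ℝ))).symm.trans ?_
    refine intervalIntegral.integral_congr fun s hs => ?_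
    rw [uIcc_of_le ht] at hs
    exact (hV s hs Λ).symm
  rw [hR, ← integral_integral_triangle hk ht]
  refine intervalIntegral.integral_congr fun s hs => ?_
  rw [uIcc_of_le ht] at hs
  exact (hF s hs ((Λ.comp ((Tbar (t - s).toNNReal).restrictScalars ℝ)).comp
    (B.restrictScalars ℝ))).symm

/-- The contraction estimate of the Volterra operator, at every time and for every continuous
function. Subtracting from `f` a cut-off of its value at `0` reduces to functions vanishing at `0`;
the error tends to `0` as the cut-off shrinks, since it is an average of
the Volterra integrals of a constant. -/
theorem seminorm_le (h : IsAdmissiblePerturbation Γ T Tbar ι B t₀)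
    {p : Seminorm 𝕜 X} (hp : Continuous p) {K : ℝ} (hK0 : 0 < K)
    (hK : VolterraBound Tbar ι B t₀ p K)
    (hf : Continuous f) (ht : t ∈ Icc 0 t₀) (hv : IsVolterra Tbar ι B f t v)
    {M : ℝ} (hM : ∀ s ∈ Icc 0 t, p (f s) ≤ M) : p v ≤ K * M := by
  have hM0 : 0 ≤ M := (apply_nonneg p _).trans (hM 0 ⟨le_rfl, ht.1⟩)
  rcases ht.1.eq_or_lt with rfl | ht0
  · rw [h.unique hv IsVolterra.at_zero, map_zero]
    positivity
  set x := f 0 with hx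
  choose! J hJ using fun t (ht : t ∈ Icc 0 t₀) => h.exists_isVolterra_const x ht.1
  have hJc := h.continuousOn_const hJ
  have hJ0 : J 0 = 0 := h.unique (hJ 0 ⟨le_rfl, h.pos.le⟩) IsVolterra.at_zero
  choose! w hw using fun ε (hε : ε ∈ Icc 0 t₀) =>
    exists_hasWeakIntegral h.seqComplete hε.1 (hJc.mono (Icc_subset_Icc_right hε.2))
  -- the cut-off at scale `ε` contributes `d ε` at time `ε`
  set d : ℝ → X := fun ε => J ε - ε⁻¹ • w ε with hd
  have hd_tendsto : Tendsto d (𝓝[>] 0) (𝓝 0) := by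
    have h1 := tendsto_inv_smul_of_hasWeakIntegral h.pos hJc fun ε hε => hw ε ⟨hε.1.le, hε.2⟩
    have h2 : Tendsto J (𝓝[>] 0) (𝓝 (J 0)) := by
      have := hJc 0 ⟨le_rfl, h.pos.le⟩
      refine Tendsto.mono_left this ?_
      rw [nhdsWithin_Icc_eq_nhdsGE h.pos]
      exact nhdsWithin_mono _ Ioi_subset_Ici_self
    simpa [hd, hJ0] using h2.sub h1
  have hd_volterra : ∀ ε ∈ Ioc 0 t₀,
      IsVolterra Tbar ι B (fun s => max 0 (1 - s / ε) • x) ε (d ε) := by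
    intro ε hε
    have hlin : IsVolterra Tbar ι B (fun s : ℝ => s • x) ε (w ε) :=
      h.isVolterra_of_hasWeakIntegral (f := fun _ => x) continuous_const hε.1.le
        (fun s _ Λ => by simp) (fun s hs => hJ s ⟨hs.1, hs.2.trans hε.2⟩)
        (hw ε ⟨hε.1.le, hε.2⟩)
    have hlin' := hlin.smul ((ε⁻¹ : ℝ) : 𝕜)
    have hsub := h.isVolterra_sub continuous_const (by fun_prop) (hJ ε ⟨hε.1.le, hε.2⟩) hlin'
    rw [← RCLike.real_smul_eq_coe_smul] at hsub
    refine hsub.congr hε.1.le fun s hs => ?_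
    have : 0 ≤ 1 - s / ε := sub_nonneg.2 ((div_le_one hε.1).2 hs.2)
    rw [max_eq_right this, sub_smul, one_smul, ← RCLike.real_smul_eq_coe_smul, smul_smul,
      div_eq_inv_mul]
  obtain ⟨q, hq, hTq⟩ := h.semigroup.exists_seminorm_bound t.toNNReal
    (p := p.restrictScalars ℝ) hp
  have key : ∀ η > 0, p v ≤ K * (M + η) + η := by
    intro η hη
    have e1 : ∀ᶠ ε in 𝓝[>] 0, q (d ε) < η := by
      simpa using tendsto_nhds_iff_seminorm.1 hd_tendsto q hq η hη
    obtain ⟨δ, hδ, hmod⟩ := hf.continuousOn.exists_seminorm_modulus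
      (isCompact_Icc (a := 0) (b := t₀)) (p := p.restrictScalars ℝ) hp hη
    have e2 : ∀ᶠ ε in 𝓝[>] (0 : ℝ), ε ∈ Ioo 0 (min δ t) := Ioo_mem_nhdsGT (lt_min hδ ht0)
    obtain ⟨ε, hqε, hε⟩ := (e1.and e2).exists
    have hεt : ε ≤ t := hε.2.le.trans (min_le_right _ _)
    have hdt := h.isVolterra_cutoff hε.1 hεt (hd_volterra ε ⟨hε.1, hεt.trans ht.2⟩)
    have hgc : Continuous fun s : ℝ => f s - max 0 (1 - s / ε) • x :=
      hf.sub (continuous_cutoff ε x)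
    have hg := h.isVolterra_sub hf (continuous_cutoff ε x) hv hdt
    have hle := h.seminorm_le_of_zero hK hgc (by simp [hx]) ht hg (M := M + η) fun s hs => by
      rcases le_total ε s with hεs | hsε
      · have : 1 - s / ε ≤ 0 := sub_nonpos.2 ((one_le_div hε.1).2 hεs)
        simp only [max_eq_left this, zero_smul, sub_zero]
        linarith [hM s hs]
      · have h0 : 0 ≤ s / ε := div_nonneg hs.1 hε.1.le
        have h1 : 0 ≤ 1 - s / ε := sub_nonneg.2 ((div_le_one hε.1).2 hsε)
        have e : f s - (1 - s / ε) • x = (s / ε) • x + (f s - f 0) := by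
          rw [sub_smul, one_smul, hx]; abel
        rw [max_eq_right h1, e]
        refine (map_add_le_add p _ _).trans (add_le_add ?_ (le_of_lt ?_))
        · rw [← Seminorm.coe_restrictScalars ℝ p, map_smul_eq_mul, Real.norm_eq_abs,
            abs_of_nonneg h0]
          calc s / ε * p.restrictScalars ℝ x ≤ 1 * p.restrictScalars ℝ x :=
                mul_le_mul_of_nonneg_right (by linarith) (apply_nonneg _ _)
            _ ≤ M := by rw [one_mul]; exact hM 0 ⟨le_rfl, ht.1⟩
        · refine hmod s ⟨hs.1, hs.2.trans ht.2⟩ 0 ⟨le_rfl, h.pos.le⟩ ?_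
          rw [sub_zero, abs_of_nonneg hs.1]
          exact hsε.trans (hε.2.le.trans (min_le_left _ _))
    have hpd : p (T (t - ε).toNNReal (d ε)) ≤ q (d ε) :=
      hTq _ (Real.toNNReal_le_toNNReal (by linarith [hε.1])) _
    calc p v = p ((v - T (t - ε).toNNReal (d ε)) + T (t - ε).toNNReal (d ε)) := by
          rw [sub_add_cancel]
      _ ≤ p (v - T (t - ε).toNNReal (d ε)) + p (T (t - ε).toNNReal (d ε)) := map_add_le_add p _ _
      _ ≤ K * (M + η) + η := add_le_add hle (hpd.trans hqε.le)
  refine le_of_forall_pos_le_add fun η hη => ?_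
  have := key (η / (K + 1)) (by positivity)
  refine this.trans_eq ?_
  field_simp
  ring

end IsAdmissiblePerturbation

end Volterra

/-! ### Extension of local semigroups -/

section LocalSemigroup

variable {𝕜 Y : Type*} [RCLike 𝕜] [AddCommGroup Y] [Module 𝕜 Y]

section Algebra

variable [TopologicalSpace Y] {W : ℝ≥0 → Y →L[𝕜] Y} {τ : ℝ≥0}

theorem local_semigroup_pow (h0 : W 0 = ContinuousLinearMap.id 𝕜 Y)
    (hadd : ∀ t s, t + s ≤ τ → W (t + s) = (W t).comp (W s)) {s : ℝ≥0} :
    ∀ m : ℕ, m * s ≤ τ → W s ^ m = W (m * s)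
  | 0, _ => by simp only [pow_zero, Nat.cast_zero, zero_mul, h0]; rfl
  | m + 1, hm => by
    have e : ((m + 1 : ℕ) : ℝ≥0) * s = m * s + s := by push_cast; ring
    rw [e] at hm ⊢
    rw [pow_succ, local_semigroup_pow h0 hadd m (le_self_add.trans hm), hadd _ _ hm]
    rfl

/-- The value `W (t / n) ^ n` of the extended semigroup does not depend on `n`. -/
theorem local_semigroup_pow_eq (h0 : W 0 = ContinuousLinearMap.id 𝕜 Y)
    (hadd : ∀ t s, t + s ≤ τ → W (t + s) = (W t).comp (W s)) {t : ℝ≥0} {m n : ℕ}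
    (hm0 : 0 < m) (hn0 : 0 < n) (hm : t / m ≤ τ) (hn : t / n ≤ τ) :
    W (t / m) ^ m = W (t / n) ^ n := by
  have key : ∀ m n : ℕ, 0 < m → 0 < n → t / m ≤ τ →
      W (t / m) ^ m = W (t / (m * n)) ^ (m * n) := by
    intro m n hm0 hn0 hm
    have hm' : (m : ℝ≥0) ≠ 0 := by exact_mod_cast hm0.ne'
    have hn' : (n : ℝ≥0) ≠ 0 := by exact_mod_cast hn0.ne'
    have e : (n : ℝ≥0) * (t / (m * n)) = t / m := by field_simp
    rw [mul_comm m n, pow_mul, local_semigroup_pow h0 hadd n (e.trans_le hm), e]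
  rw [key m n hm0 hn0 hm, key n m hn0 hm0 hn, mul_comm (m : ℝ≥0), mul_comm m n]

end Algebra

theorem equicontinuous_iff_nhds_zero [UniformSpace Y] [IsUniformAddGroup Y] {I : Type*}
    {F : I → Y →L[𝕜] Y} :
    Equicontinuous (fun i x => F i x) ↔
      ∀ U ∈ 𝓝 (0 : Y), ∃ V ∈ 𝓝 (0 : Y), ∀ i, ∀ x ∈ V, F i x ∈ U := by
  constructor
  · intro h U hU
    have hV : {q : Y × Y | q.2 - q.1 ∈ U} ∈ uniformity Y := by
      rw [uniformity_eq_comap_nhds_zero]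
      exact ⟨U, hU, fun q hq => hq⟩
    exact ⟨_, h 0 _ hV, fun i x hx => by simpa using hx i⟩
  · intro h
    refine equicontinuous_of_equicontinuousAt_zero F fun V hV => ?_
    rw [uniformity_eq_comap_nhds_zero] at hV
    obtain ⟨U, hU, hUV⟩ := hV
    obtain ⟨V', hV', hi⟩ := h U hU
    filter_upwards [hV'] with x hx i
    exact hUV (by simpa using hi i x hx)

variable [UniformSpace Y] [IsUniformAddGroup Y]

/-- A locally equicontinuous semigroup defined on `[0, τ]` extends to `[0, ∞)`. -/
theorem exists_semigroup_of_local {W : ℝ≥0 → Y →L[𝕜] Y} {τ : ℝ≥0} (hτ : 0 < τ)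
    (h0 : W 0 = ContinuousLinearMap.id 𝕜 Y)
    (hadd : ∀ t s, t + s ≤ τ → W (t + s) = (W t).comp (W s))
    (hcont : ∀ x, ContinuousOn (fun t => W t x) (Icc 0 τ))
    (hequi : Equicontinuous fun (t : Icc 0 τ) (x : Y) => W t x) :
    ∃ S : ℝ≥0 → Y →L[𝕜] Y, IsLocallyEquicontinuousC0Semigroup S ∧ ∀ t ≤ τ, S t = W t := by
  have hn : ∀ t : ℝ≥0, ∃ n : ℕ, 0 < n ∧ t / n ≤ τ := fun t => by
    obtain ⟨n, hn⟩ := exists_nat_ge (t / τ)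
    refine ⟨n + 1, n.succ_pos, ?_⟩
    rw [div_le_iff₀ (by positivity)]
    rw [div_le_iff₀ hτ] at hn
    push_cast
    calc t ≤ n * τ := hn
      _ ≤ τ * (n + 1) := by rw [mul_comm]; gcongr; simp
  choose N hN0 hN using hn
  set S : ℝ≥0 → Y →L[𝕜] Y := fun t => W (t / N t) ^ N t with hS
  have hSn : ∀ t : ℝ≥0, ∀ n : ℕ, 0 < n → t / n ≤ τ → S t = W (t / n) ^ n := fun t n h1 h2 =>
    local_semigroup_pow_eq h0 hadd (hN0 t) h1 (hN t) h2
  have hSW : ∀ t ≤ τ, S t = W t := fun t ht => by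
    simpa using hSn t 1 one_pos (by simpa using ht)
  have hSadd : ∀ t s, S (t + s) = (S t).comp (S s) := by
    intro t s
    have hts := hN (t + s)
    set n := N (t + s) with hndef
    have hle1 : t / n ≤ τ := le_trans (by gcongr; exact le_self_add) hts
    have hle2 : s / n ≤ τ := le_trans (by gcongr; exact le_add_self) hts
    rw [hSn t n (hN0 _) hle1, hSn s n (hN0 _) hle2]
    have e1 : W ((t + s) / n) = W (t / n) * W (s / n) := by
      rw [add_div] at hts ⊢
      exact hadd _ _ hts
    have e2 : W ((t + s) / n) = W (s / n) * W (t / n) := by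
      rw [add_comm, add_div]
      rw [add_comm, add_div] at hts
      exact hadd _ _ hts
    have hcomm : Commute (W (t / n)) (W (s / n)) := e1.symm.trans e2
    change W ((t + s) / n) ^ n = _
    rw [e1, hcomm.mul_pow]
    rfl
  refine ⟨S, ⟨?_, hSadd, ?_, ?_⟩, hSW⟩
  · rw [hSW 0 zero_le, h0]
  · intro x
    rw [continuous_iff_continuousAt]
    intro t
    -- near `t`, the orbit is a local orbit restarted at the time `a`
    set a := t - τ / 2 with ha
    have hτ2 : 0 < τ / 2 := half_pos hτ
    have hat : a ≤ t := tsub_le_self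
    have hta : t < a + τ :=
      (tsub_le_iff_right.1 le_rfl : t ≤ a + τ / 2).trans_lt
        (add_lt_add_of_le_of_lt le_rfl (half_lt_self hτ))
    have hmem : Icc a (a + τ) ∈ 𝓝 t := by
      have h1 : ∀ᶠ r in 𝓝 t, r < a + τ := gt_mem_nhds hta
      have h2 : ∀ᶠ r in 𝓝 t, a ≤ r := by
        rcases eq_or_ne t 0 with rfl | ht
        · exact Eventually.of_forall fun r => by simp [ha]
        · exact (lt_mem_nhds (tsub_lt_self (pos_iff_ne_zero.2 ht) hτ2)).mono fun r hr => hr.le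
      filter_upwards [h1, h2] with r hr1 hr2 using ⟨hr2, hr1.le⟩
    refine ContinuousOn.continuousAt ?_ hmem
    have hc : ContinuousOn (fun r => W (r - a) (S a x)) (Icc a (a + τ)) := by
      refine (hcont (S a x)).comp (by fun_prop : Continuous fun r : ℝ≥0 => r - a).continuousOn ?_
      exact fun r hr => ⟨zero_le, tsub_le_iff_left.2 hr.2⟩
    refine hc.congr fun r hr => ?_
    have : S r = (S (r - a)).comp (S a) := by rw [← hSadd, tsub_add_cancel_of_le hr.1]
    simp only
    rw [this, hSW _ (tsub_le_iff_left.2 hr.2)]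
    rfl
  · intro t₁
    rw [equicontinuous_iff_nhds_zero] at hequi ⊢
    have hpow : ∀ k : ℕ, ∀ U ∈ 𝓝 (0 : Y), ∃ V ∈ 𝓝 (0 : Y), ∀ s ≤ τ, ∀ x ∈ V, (W s ^ k) x ∈ U := by
      intro k
      induction k with
      | zero => exact fun U hU => ⟨U, hU, fun s _ x hx => hx⟩
      | succ k ih =>
        intro U hU
        obtain ⟨V, hV, h1⟩ := hequi U hU
        obtain ⟨V', hV', h2⟩ := ih V hV
        refine ⟨V', hV', fun s hs x hx => ?_⟩
        rw [pow_succ']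
        exact h1 ⟨s, zero_le, hs⟩ _ (h2 s hs x hx)
    intro U hU
    obtain ⟨V, hV, h⟩ := hpow (N t₁) U hU
    refine ⟨V, hV, fun t x hx => ?_⟩
    have hle : t.1 / N t₁ ≤ τ := le_trans (by gcongr; exact t.2.2) (hN t₁)
    rw [hSn t.1 (N t₁) (hN0 t₁) hle]
    exact h _ hle x hx

end LocalSemigroup

/-! ### The perturbed semigroup -/

section Perturbed

set_option linter.unusedSectionVars false

variable {𝕜 X Xbar : Type*} [RCLike 𝕜]
  [AddCommGroup X] [Module 𝕜 X] [Module ℝ X] [IsScalarTower ℝ 𝕜 X] [UniformSpace X]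
  [AddCommGroup Xbar] [Module 𝕜 Xbar] [Module ℝ Xbar] [IsScalarTower ℝ 𝕜 Xbar]
  [UniformSpace Xbar]
  [IsUniformAddGroup X] [ContinuousSMul 𝕜 X] [ContinuousSMul ℝ X] [LocallyConvexSpace ℝ X]
  [T2Space X]
  [IsUniformAddGroup Xbar] [ContinuousSMul 𝕜 Xbar] [ContinuousSMul ℝ Xbar]
  [LocallyConvexSpace ℝ Xbar] [T2Space Xbar]
  {Γ : Set (Seminorm 𝕜 X)} {T : ℝ≥0 → X →L[𝕜] X} {Tbar : ℝ≥0 → Xbar →L[𝕜] Xbar}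
  {ι B : X →L[𝕜] Xbar} {t₀ : ℝ} {f g : ℝ → X} {t s : ℝ} {v w x : X}

/-- `u` solves the Volterra equation `u = g + V u` on `[0, τ]`, where `V` is the
Volterra operator. -/
def IsVolterraSolution (Tbar : ℝ≥0 → Xbar →L[𝕜] Xbar) (ι B : X →L[𝕜] Xbar) (τ : ℝ)
    (g u : ℝ → X) : Prop :=
  ∀ t ∈ Icc 0 τ, IsVolterra Tbar ι B u t (u t - g t)

namespace IsAdmissiblePerturbation

theorem eq_of_forall_seminorm (h : IsAdmissiblePerturbation Γ T Tbar ι B t₀)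
    (hp : ∀ p ∈ Γ, p (v - w) = 0) : v = w := by
  by_contra hvw
  obtain ⟨p, hp'⟩ := h.withSeminorms.separating_of_T1 (v - w) (sub_ne_zero.2 hvw)
  exact hp' (hp p p.2)

theorem exists_continuous_volterra (h : IsAdmissiblePerturbation Γ T Tbar ι B t₀)
    (hf : Continuous f) :
    ∃ V : ℝ → X, Continuous V ∧ ∀ t ∈ Icc 0 t₀, IsVolterra Tbar ι B f t (V t) := by
  choose! V hV using fun t (ht : t ∈ Icc 0 t₀) => h.exists_isVolterra hf ht
  refine ⟨IccExtend h.pos.le ((Icc 0 t₀).domRestrict V),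
    (continuousOn_iff_continuous_domRestrict.1 (h.continuousOn_volterra hf hV)).Icc_extend', ?_⟩
  intro t ht
  rw [IccExtend_of_mem _ _ ht]
  exact hV t ht

/-- A priori estimate for the Volterra equation. -/
theorem solution_seminorm_le (h : IsAdmissiblePerturbation Γ T Tbar ι B t₀)
    {p : Seminorm 𝕜 X} (hp : Continuous p) {K : ℝ} (hK0 : 0 < K) (hK1 : K < 1)
    (hK : VolterraBound Tbar ι B t₀ p K) {τ : ℝ} (hτ : τ ∈ Icc 0 t₀) {u : ℝ → X}
    (hu : Continuous u) (hsol : IsVolterraSolution Tbar ι B τ g u) {M : ℝ}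
    (hM : ∀ t ∈ Icc 0 τ, p (g t) ≤ M) (ht : t ∈ Icc 0 τ) : p (u t) ≤ (1 - K)⁻¹ * M := by
  obtain ⟨s, hs, hmax⟩ := isCompact_Icc.exists_isMaxOn (nonempty_Icc.2 hτ.1)
    (hp.comp hu).continuousOn
  have h1 : p (u s - g s) ≤ K * p (u s) :=
    h.seminorm_le hp hK0 hK hu ⟨hs.1, hs.2.trans hτ.2⟩ (hsol s hs) fun r hr =>
      hmax ⟨hr.1, hr.2.trans hs.2⟩
  have h2 : p (u s) ≤ p (u s - g s) + p (g s) := by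
    simpa using map_add_le_add p (u s - g s) (g s)
  have h3 : p (u t) ≤ p (u s) := hmax ht
  rw [← div_eq_inv_mul, le_div_iff₀ (by linarith)]
  nlinarith [hM s hs]

theorem solution_unique (h : IsAdmissiblePerturbation Γ T Tbar ι B t₀) {τ : ℝ}
    (hτ : τ ∈ Icc 0 t₀) {u u' : ℝ → X} (hu : Continuous u) (hu' : Continuous u')
    (hsol : IsVolterraSolution Tbar ι B τ g u) (hsol' : IsVolterraSolution Tbar ι B τ g u')
    (ht : t ∈ Icc 0 τ) : u t = u' t := by
  refine h.eq_of_forall_seminorm fun p hp => le_antisymm ?_ (apply_nonneg _ _)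
  obtain ⟨K, hK0, hK1, hK⟩ := h.volterra_bound p hp
  have hd : IsVolterraSolution Tbar ι B τ (fun _ => 0) (fun s => u s - u' s) := fun t ht => by
    simpa using h.isVolterra_sub hu hu' (hsol t ht) (hsol' t ht)
  simpa using h.solution_seminorm_le (h.fundamental.1 p hp) hK0 hK1 hK hτ (hu.sub hu') hd
    (M := 0) (fun _ _ => by simp) ht

/-- The Volterra equation has a solution, the limit of the Picard iterates. -/
theorem exists_solution (h : IsAdmissiblePerturbation Γ T Tbar ι B t₀) (hg : Continuous g) :
    ∃ u : ℝ → X, Continuous u ∧ IsVolterraSolution Tbar ι B t₀ g u := by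
  choose! V hVc hV using fun (f : ℝ → X) (hf : Continuous f) => h.exists_continuous_volterra hf
  let u : ℕ → ℝ → X := fun n => n.rec g fun _ f t => g t + V f t
  have hu0 : u 0 = g := rfl
  have husucc : ∀ n t, u (n + 1) t = g t + V (u n) t := fun n t => rfl
  have huc : ∀ n, Continuous (u n) := fun n => by
    induction n with
    | zero => exact hg
    | succ n ih => exact hg.add (hVc _ ih)
  clear_value u
  have hcontract : ∀ p ∈ Γ, ∃ K C : ℝ, 0 < K ∧ K < 1 ∧ VolterraBound Tbar ι B t₀ p K ∧
      ∀ n k, ∀ t ∈ Icc 0 t₀, p (u (n + k) t - u n t) ≤ K ^ n * C := by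
    intro p hp
    have hpc := h.fundamental.1 p hp
    obtain ⟨K, hK0, hK1, hK⟩ := h.volterra_bound p hp
    obtain ⟨M, hM⟩ := (isCompact_Icc (a := 0) (b := t₀)).bddAbove_image
      (hpc.comp (hVc g hg)).continuousOn
    have hM : ∀ t ∈ Icc 0 t₀, p (V g t) ≤ M := fun t ht => hM (mem_image_of_mem _ ht)
    have hM0 : 0 ≤ M := (apply_nonneg p _).trans (hM 0 ⟨le_rfl, h.pos.le⟩)
    have hK1' : 0 < 1 - K := sub_pos.2 hK1
    have hC0 : 0 ≤ M / (1 - K) := div_nonneg hM0 hK1'.le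
    have hstep : ∀ m n (D : ℝ), (∀ t ∈ Icc 0 t₀, p (u m t - u n t) ≤ D) →
        ∀ t ∈ Icc 0 t₀, p (u (m + 1) t - u (n + 1) t) ≤ K * D := by
      intro m n D hD t ht
      have hd := h.isVolterra_sub (huc m) (huc n) (hV _ (huc m) t ht) (hV _ (huc n) t ht)
      rw [husucc, husucc, add_sub_add_left_eq_sub]
      exact h.seminorm_le hpc hK0 hK ((huc m).sub (huc n)) ht hd fun s hs =>
        hD s ⟨hs.1, hs.2.trans ht.2⟩
    refine ⟨K, M / (1 - K), hK0, hK1, hK, fun n => ?_⟩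
    induction n with
    | zero =>
      intro k
      induction k with
      | zero => intro t _; simpa using hC0
      | succ k ih =>
        intro t ht
        have h1 := hstep _ _ _ ih t ht
        have e : u (0 + (k + 1)) t - u 0 t = (u (0 + k + 1) t - u (0 + 1) t) + V g t := by
          rw [husucc 0 t, hu0]
          simp only [zero_add]
          abel
        rw [e]
        refine (map_add_le_add p _ _).trans ((add_le_add h1 (hM t ht)).trans_eq ?_)
        field_simp
        ring
    | succ n ih =>
      intro k t ht
      have := hstep _ _ _ (ih k) t ht
      rw [show n + 1 + k = n + k + 1 by ring, pow_succ']
      linarith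
  have hpow : ∀ K C : ℝ, 0 < K → K < 1 → ∀ ε > 0, ∃ n : ℕ, K ^ n * C < ε := by
    intro K C hK0 hK1 ε hε
    have : Tendsto (fun n : ℕ => K ^ n * C) atTop (𝓝 (0 * C)) :=
      (tendsto_pow_atTop_nhds_zero_of_lt_one hK0.le hK1).mul_const C
    rw [zero_mul] at this
    exact (this.eventually (gt_mem_nhds hε)).exists
  have hlim : ∀ t ∈ Icc 0 t₀, ∃ y, Tendsto (fun n => u n t) atTop (𝓝 y) := by
    intro t ht
    refine h.seqComplete _ (h.withSeminorms.cauchySeq fun p ε hε => ?_)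
    obtain ⟨K, C, hK0, hK1, -, hKC⟩ := hcontract p p.2
    obtain ⟨N, hN⟩ := hpow K C hK0 hK1 (ε / 2) (half_pos hε)
    refine ⟨N, fun m hm n hn => ?_⟩
    obtain ⟨k, rfl⟩ := Nat.exists_eq_add_of_le hm
    obtain ⟨l, rfl⟩ := Nat.exists_eq_add_of_le hn
    have h1 := hKC N k t ht
    have h2 := hKC N l t ht
    rw [map_sub_rev] at h2
    have h3 := map_add_le_add p.1 (u (N + k) t - u N t) (u N t - u (N + l) t)
    rw [sub_add_sub_cancel] at h3
    linarith
  choose! U hU using hlim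
  have hdist : ∀ p ∈ Γ, ∃ K C : ℝ, 0 < K ∧ K < 1 ∧ VolterraBound Tbar ι B t₀ p K ∧
      ∀ n, ∀ t ∈ Icc 0 t₀, p (U t - u n t) ≤ K ^ n * C := by
    intro p hp
    obtain ⟨K, C, hK0, hK1, hK, hKC⟩ := hcontract p hp
    refine ⟨K, C, hK0, hK1, hK, fun n t ht => ?_⟩
    have hlim : Tendsto (fun k => p (u (n + k) t - u n t)) atTop (𝓝 (p (U t - u n t))) := by
      have h1 : Tendsto (fun k => u (n + k) t) atTop (𝓝 (U t)) := by
        simpa only [add_comm n] using (tendsto_add_atTop_iff_nat n).2 (hU t ht)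
      exact ((h.fundamental.1 p hp).tendsto _).comp (h1.sub_const (u n t))
    exact le_of_tendsto' hlim fun k => hKC n k t ht
  have hUc : ContinuousOn U (Icc 0 t₀) := by
    intro t ht
    refine (h.withSeminorms.tendsto_nhds U _).2 fun p ε hε => ?_
    obtain ⟨K, C, hK0, hK1, -, hKC⟩ := hdist p p.2
    obtain ⟨n, hn⟩ := hpow K C hK0 hK1 (ε / 3) (by positivity)
    have hc : ∀ᶠ r in 𝓝[Icc 0 t₀] t, p.1 (u n r - u n t) < ε / 3 :=
      (h.withSeminorms.tendsto_nhds (u n) (u n t)).1 ((huc n).continuousWithinAt) p _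
        (by positivity)
    filter_upwards [hc, self_mem_nhdsWithin] with r hr hrI
    have h1 := hKC n r hrI
    have h2 := hKC n t ht
    rw [map_sub_rev] at h2
    have h3 := map_add_le_add p.1 (U r - u n r) (u n r - u n t)
    have h4 := map_add_le_add p.1 (U r - u n t) (u n t - U t)
    rw [sub_add_sub_cancel] at h3 h4
    linarith
  refine ⟨IccExtend h.pos.le ((Icc 0 t₀).domRestrict U),
    (continuousOn_iff_continuous_domRestrict.1 hUc).Icc_extend', ?_⟩
  have hUext : ∀ s ∈ Icc 0 t₀, IccExtend h.pos.le ((Icc 0 t₀).domRestrict U) s = U s := fun s hs =>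
    IccExtend_of_mem _ _ hs
  have hUextc : Continuous (IccExtend h.pos.le ((Icc 0 t₀).domRestrict U)) :=
    (continuousOn_iff_continuous_domRestrict.1 hUc).Icc_extend'
  set U' := IccExtend h.pos.le ((Icc 0 t₀).domRestrict U)
  intro t ht
  obtain ⟨v, hv⟩ := h.exists_isVolterra hUextc ht
  suffices hvU : v = U' t - g t by rwa [← hvU]
  refine h.eq_of_forall_seminorm fun p hp => le_antisymm ?_ (apply_nonneg _ _)
  obtain ⟨K, C, hK0, hK1, hK, hKC⟩ := hdist p hp
  refine le_of_forall_pos_lt_add fun ε hε => ?_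
  obtain ⟨n, hn⟩ := hpow K C hK0 hK1 (ε / 2) (half_pos hε)
  have h1 : p (v - V (u n) t) ≤ K * (K ^ n * C) :=
    h.seminorm_le (h.fundamental.1 p hp) hK0 hK (hUextc.sub (huc n)) ht
      (h.isVolterra_sub hUextc (huc n) hv (hV _ (huc n) t ht)) fun s hs => by
        have hs' : s ∈ Icc 0 t₀ := ⟨hs.1, hs.2.trans ht.2⟩
        change p (U' s - u n s) ≤ _
        rw [hUext s hs']
        exact hKC n s hs'
  have h2 := hKC (n + 1) t ht
  rw [map_sub_rev, husucc, pow_succ', mul_assoc] at h2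
  have h3 := map_add_le_add p (v - V (u n) t) (g t + V (u n) t - U t)
  have e : v - V (u n) t + (g t + V (u n) t - U t) = v - (U' t - g t) := by
    rw [hUext t ht]; abel
  rw [e] at h3
  have hKn : K * (K ^ n * C) ≤ K ^ n * C := by
    have : 0 ≤ K ^ n * C := (apply_nonneg p _).trans (hKC n t ht)
    nlinarith
  linarith

/-- The perturbed semigroup: its orbits solve the Volterra equation on `[0, t₀]`. -/
theorem exists_perturbed_semigroup (h : IsAdmissiblePerturbation Γ T Tbar ι B t₀) :
    ∃ S : ℝ≥0 → X →L[𝕜] X, IsLocallyEquicontinuousC0Semigroup S ∧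
      ∀ x, IsVolterraSolution Tbar ι B t₀ (fun t => T t.toNNReal x) (fun t => S t.toNNReal x) := by
  choose u huc hu using fun x : X => h.exists_solution (h.semigroup.continuous_orbit_real x)
  have htop : t₀ ∈ Icc 0 t₀ := ⟨h.pos.le, le_rfl⟩
  have hadd : ∀ x y, ∀ t ∈ Icc 0 t₀, u (x + y) t = u x t + u y t := fun x y t ht =>
    h.solution_unique htop (huc _) ((huc x).add (huc y)) (hu (x + y)) (fun s hs => by
      have := h.isVolterra_add (huc x) (huc y) (hu x s hs) (hu y s hs)
      rwa [sub_add_sub_comm, ← map_add] at this) ht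
  have hsmul : ∀ (c : 𝕜) x, ∀ t ∈ Icc 0 t₀, u (c • x) t = c • u x t := fun c x t ht =>
    h.solution_unique htop (huc _) ((huc x).const_smul c) (hu (c • x)) (fun s hs => by
      have := (hu x s hs).smul c
      rwa [smul_sub, ← map_smul] at this) ht
  have hbound : ∀ p ∈ Γ, ∃ q : Seminorm 𝕜 X, Continuous q ∧
      ∀ x, ∀ t ∈ Icc 0 t₀, p (u x t) ≤ q x := by
    intro p hp
    obtain ⟨K, hK0, hK1, hK⟩ := h.volterra_bound p hp
    obtain ⟨q, hq, hle⟩ := h.semigroup.exists_seminorm_bound_rclike t₀.toNNReal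
      (h.fundamental.1 p hp)
    have hK' : 0 ≤ (1 - K)⁻¹ := inv_nonneg.2 (by linarith)
    refine ⟨Real.toNNReal (1 - K)⁻¹ • q, hq.const_smul (Real.toNNReal (1 - K)⁻¹),
      fun x t ht => ?_⟩
    have := h.solution_seminorm_le (h.fundamental.1 p hp) hK0 hK1 hK htop (huc x) (hu x)
      (M := q x) (fun s hs => hle _ (Real.toNNReal_le_toNNReal hs.2) x) ht
    rwa [_root_.smul_apply, NNReal.smul_def, Real.coe_toNNReal _ hK', smul_eq_mul]
  have hmem : ∀ t : ℝ≥0, min (t : ℝ) t₀ ∈ Icc 0 t₀ := fun t =>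
    ⟨le_min t.2 h.pos.le, min_le_right _ _⟩
  let W : ℝ≥0 → X →L[𝕜] X := fun t =>
    { toFun := fun x => u x (min t t₀)
      map_add' := fun x y => hadd x y _ (hmem t)
      map_smul' := fun c x => hsmul c x _ (hmem t)
      cont := by
        let L : X →+ X := ⟨⟨fun x => u x (min t t₀), by simpa using hsmul 0 0 _ (hmem t)⟩,
          fun x y => hadd x y _ (hmem t)⟩
        refine continuous_of_continuousAt_zero L ?_
        refine (h.withSeminorms.tendsto_nhds _ _).2 fun p ε hε => ?_
        obtain ⟨q, hq, hle⟩ := hbound p p.2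
        filter_upwards [(hq.tendsto' 0 0 (map_zero q)).eventually (gt_mem_nhds hε)] with x hx
        rw [map_zero, sub_zero]
        exact (hle x _ (hmem t)).trans_lt hx }
  have hW : ∀ (t : ℝ≥0) x, (t : ℝ) ≤ t₀ → W t x = u x t := fun t x ht => by
    change u x (min t t₀) = u x t
    rw [min_eq_left ht]
  have hτ : (t₀.toNNReal : ℝ) = t₀ := Real.coe_toNNReal _ h.pos.le
  have hcoe : ∀ {t : ℝ≥0}, t ≤ t₀.toNNReal → (t : ℝ) ≤ t₀ := fun ht => by
    rw [← hτ]; exact_mod_cast ht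
  have hu0 : ∀ x, u x 0 = x := fun x => by
    have := h.unique (hu x 0 ⟨le_rfl, h.pos.le⟩) IsVolterra.at_zero
    simpa [sub_eq_zero, h.semigroup.map_zero] using this
  have hW0 : W 0 = ContinuousLinearMap.id 𝕜 X := by
    ext x
    rw [hW _ _ (by simpa using h.pos.le)]
    exact hu0 x
  have hWadd : ∀ t s, t + s ≤ t₀.toNNReal → W (t + s) = (W t).comp (W s) := by
    intro t s hts
    have hts' := hcoe hts
    push_cast at hts'
    have ht0 : 0 ≤ (t : ℝ) := t.2
    have hs0 : 0 ≤ (s : ℝ) := s.2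
    ext x
    rw [ContinuousLinearMap.comp_apply, hW _ _ (by push_cast; linarith), hW s _ (by linarith),
      hW t _ (by linarith)]
    push_cast
    -- both sides solve the Volterra equation started at `u x s`
    refine h.solution_unique (τ := t₀ - s) (g := fun r => T r.toNNReal (u x s))
      (u := fun r => u x (r + s)) ⟨by linarith, by linarith⟩
      ((huc x).comp (by fun_prop)) (huc (u x s)) (fun r hr => ?_)
      (fun r hr => hu _ r ⟨hr.1, by linarith [hr.2]⟩) ⟨ht0, by linarith⟩
    refine (h.isVolterra_shift_iff (huc x) hs0 hr.1 (hu x s ⟨hs0, by linarith⟩)).2 ?_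
    have := hu x (r + s) ⟨by linarith [hr.1], by linarith [hr.2]⟩
    simp only [h.semigroup.map_toNNReal_add hr.1 hs0] at this
    simp only [map_sub]
    convert! this using 1
    abel
  have hWcont : ∀ x, ContinuousOn (fun t => W t x) (Icc 0 t₀.toNNReal) := by
    intro x
    have : Continuous fun t : ℝ≥0 => u x t := (huc x).comp NNReal.continuous_coe
    exact this.continuousOn.congr fun t ht => hW t x (hcoe ht.2)
  have hWequi : Equicontinuous fun (t : Icc 0 t₀.toNNReal) (x : X) => W t x := by
    refine ((h.withSeminorms.equicontinuous_TFAE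
      (fun t : Icc 0 t₀.toNNReal => (W t : X →ₗ[𝕜] X))).out 3 1).1 fun p => ?_
    obtain ⟨q, hq, hle⟩ := hbound p p.2
    exact ⟨q, hq, fun t x => hle x _ (hmem t)⟩
  obtain ⟨S, hS, hSW⟩ := exists_semigroup_of_local (Real.toNNReal_pos.2 h.pos) hW0 hWadd hWcont
    hWequi
  refine ⟨S, hS, fun x t ht => ?_⟩
  have e : ∀ s ∈ Icc 0 t₀, S s.toNNReal x = u x s := fun s hs => by
    rw [hSW _ (Real.toNNReal_le_toNNReal hs.2), hW, Real.coe_toNNReal _ hs.1]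
    rw [Real.coe_toNNReal _ hs.1]
    exact hs.2
  change IsVolterra Tbar ι B (fun t => S t.toNNReal x) t (S t.toNNReal x - T t.toNNReal x)
  rw [e t ht]
  exact (hu x t ht).congr ht.1 fun s hs => (e s ⟨hs.1, hs.2.trans ht.2⟩).symm

end IsAdmissiblePerturbation

end Perturbed

/-! ### The generator of the perturbed semigroup -/

section Generator

open MeasureTheory

section Primitive

variable {Y : Type*} [AddCommGroup Y] [Module ℝ Y] [UniformSpace Y] [IsUniformAddGroup Y]
  [ContinuousSMul ℝ Y] [LocallyConvexSpace ℝ Y]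

theorem exists_continuous_primitive (hY : SeqComplete Y) {g : ℝ → Y} (hg : Continuous g) {τ : ℝ}
    (hτ : 0 ≤ τ) : ∃ F : ℝ → Y, Continuous F ∧ ∀ t ∈ Icc 0 τ, HasWeakIntegral g 0 t (F t) := by
  choose! F hF using fun t (ht : t ∈ Icc 0 τ) =>
    exists_hasWeakIntegral hY ht.1 hg.continuousOn
  have hFc : ContinuousOn F (Icc 0 τ) := by
    intro t ht
    refine tendsto_nhds_iff_seminorm.2 fun p hp ε hε => ?_
    obtain ⟨M, hM⟩ := (isCompact_Icc (a := 0) (b := τ)).bddAbove_image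
      (hp.comp hg).continuousOn
    have hM : ∀ s ∈ Icc 0 τ, p (g s) ≤ M := fun s hs => hM (mem_image_of_mem _ hs)
    have hM0 : 0 ≤ M := (apply_nonneg p _).trans (hM t ht)
    have hclose : ∀ᶠ r in 𝓝[Icc 0 τ] t, dist r t < ε / (M + 1) :=
      nhdsWithin_le_nhds (Metric.ball_mem_nhds t (by positivity))
    filter_upwards [hclose, self_mem_nhdsWithin] with r hr hrI
    obtain ⟨Λ, hΛ, he⟩ := exists_dual_eq_seminorm hp (F r - F t)
    have hint : ∀ a b, IntervalIntegrable (fun s => Λ (g s)) volume a b := fun a b =>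
      (Λ.continuous.comp hg).intervalIntegrable a b
    have hd : Λ (F r - F t) = ∫ s in t..r, Λ (g s) := by
      rw [map_sub, ← hF r hrI Λ, ← hF t ht Λ,
        intervalIntegral.integral_interval_sub_left (hint _ _) (hint _ _)]
    have hle : ‖∫ s in t..r, Λ (g s)‖ ≤ M * |r - t| :=
      intervalIntegral.norm_integral_le_of_norm_le_const fun s hs =>
        (hΛ _).trans (hM s (uIcc_subset_Icc ht hrI (uIoc_subset_uIcc hs)))
    rw [Real.dist_eq, lt_div_iff₀ (by positivity)] at hr
    rw [← he, hd]
    nlinarith [Real.le_norm_self (∫ s in t..r, Λ (g s)), abs_nonneg (r - t)]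
  refine ⟨IccExtend hτ ((Icc 0 τ).domRestrict F),
    (continuousOn_iff_continuous_domRestrict.1 hFc).Icc_extend', fun t ht => ?_⟩
  rw [IccExtend_of_mem _ _ ht]
  exact hF t ht

end Primitive

/-- The generator of a semigroup is densely defined: averages of orbits lie in its domain. -/
theorem IsGeneratorOf.dense_domain {𝕜 Y : Type*} [RCLike 𝕜] [AddCommGroup Y] [Module 𝕜 Y]
    [Module ℝ Y] [IsScalarTower ℝ 𝕜 Y] [UniformSpace Y] [IsUniformAddGroup Y] [ContinuousSMul ℝ Y]
    [LocallyConvexSpace ℝ Y] (hY : SeqComplete Y) {A : Y →ₗ.[𝕜] Y} {S : ℝ≥0 → Y →L[𝕜] Y}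
    (hS : IsLocallyEquicontinuousC0Semigroup S) (hA : IsGeneratorOf A S) :
    Dense (A.domain : Set Y) := by
  intro x
  have hc := hS.continuous_orbit_real x
  choose! J hJ using fun t (ht : t ∈ Ioc (0 : ℝ) 1) =>
    exists_hasWeakIntegral hY ht.1.le hc.continuousOn
  have hlim := tendsto_inv_smul_of_hasWeakIntegral one_pos hc.continuousOn hJ
  simp only [Real.toNNReal_zero, hS.map_zero, ContinuousLinearMap.id_apply] at hlim
  refine mem_closure_of_tendsto hlim ?_
  filter_upwards [Ioc_mem_nhdsGT (one_pos (α := ℝ))] with t ht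
  have hmem : J t ∈ A.domain := LinearPMap.mem_domain_of_mem_graph
    ((hA _ _).2 (hS.tendsto_of_hasWeakIntegral_orbit ht.1.le (hJ t ht)))
  rw [← algebraMap_smul 𝕜 t⁻¹ (J t)]
  exact A.domain.smul_mem _ hmem

section Perturbed

variable {𝕜 X Xbar : Type*} [RCLike 𝕜]
  [AddCommGroup X] [Module 𝕜 X] [Module ℝ X] [IsScalarTower ℝ 𝕜 X] [UniformSpace X]
  [AddCommGroup Xbar] [Module 𝕜 Xbar] [Module ℝ Xbar] [IsScalarTower ℝ 𝕜 Xbar]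
  [UniformSpace Xbar]
  [IsUniformAddGroup X] [ContinuousSMul 𝕜 X] [ContinuousSMul ℝ X] [LocallyConvexSpace ℝ X]
  [T2Space X]
  [IsUniformAddGroup Xbar] [ContinuousSMul 𝕜 Xbar] [ContinuousSMul ℝ Xbar]
  [LocallyConvexSpace ℝ Xbar] [T2Space Xbar]
  {Γ : Set (Seminorm 𝕜 X)} {T S : ℝ≥0 → X →L[𝕜] X} {Tbar : ℝ≥0 → Xbar →L[𝕜] Xbar}
  {ι B : X →L[𝕜] Xbar} {t₀ : ℝ}

namespace IsAdmissiblePerturbation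

/-- If `S` solves the Volterra equation, then `S t x` can be differentiated at `0` in the space
`Xbar`. -/
theorem tendsto_of_solution (h : IsAdmissiblePerturbation Γ T Tbar ι B t₀)
    (hS : IsLocallyEquicontinuousC0Semigroup S) {x : X} {z : Xbar}
    (hsol : IsVolterraSolution Tbar ι B t₀ (fun t => T t.toNNReal x) (fun t => S t.toNNReal x))
    (hz : Tendsto (fun t : ℝ≥0 => (t : ℝ)⁻¹ • (Tbar t (ι x) - ι x)) (𝓝[>] 0) (𝓝 z)) :
    Tendsto (fun t : ℝ≥0 => ι ((t : ℝ)⁻¹ • (S t x - x))) (𝓝[>] 0) (𝓝 (z + B x)) := by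
  have h1 := (tendsto_inv_smul_of_hasWeakIntegral_kernel
    (h.continuous_kernel (hS.continuous_orbit_real x)) h.pos
    (G := fun t => ι (S t.toNNReal x - T t.toNNReal x))
    fun t ht => hsol t ⟨ht.1.le, ht.2⟩).comp NNReal.tendsto_coe_nhdsGT_zero
  simp only [Real.toNNReal_zero, hS.map_zero, h.semigroup_ext.map_zero,
    ContinuousLinearMap.id_apply] at h1
  refine (hz.add h1).congr fun t => ?_
  simp only [Function.comp_apply, Real.toNNReal_coe, h.ext_apply, ← map_sub]
  rw [← smul_add, ← map_add, ContinuousLinearMap.map_smul_of_tower]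
  congr 2
  abel

/-- The orbit of a vector of the domain of the perturbed generator is an antiderivative: the
candidate `x + ∫₀ᵗ S s y ds` solves the same Volterra equation, by the interchange of the
Volterra operator with integration. -/
theorem hasWeakIntegral_solution (h : IsAdmissiblePerturbation Γ T Tbar ι B t₀)
    (hS : IsLocallyEquicontinuousC0Semigroup S)
    (hsol : ∀ x, IsVolterraSolution Tbar ι B t₀ (fun t => T t.toNNReal x)
      (fun t => S t.toNNReal x)) {x y : X}
    (hy : Tendsto (fun t : ℝ≥0 => (t : ℝ)⁻¹ • (Tbar t (ι x) - ι x)) (𝓝[>] 0)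
      (𝓝 (ι y - B x))) {t : ℝ} (ht : t ∈ Icc 0 t₀) :
    HasWeakIntegral (fun s => S s.toNNReal y) 0 t (S t.toNNReal x - x) := by
  have hSc := hS.continuous_orbit_real
  have hTc := h.semigroup.continuous_orbit_real
  obtain ⟨F, hFc, hF⟩ := exists_continuous_primitive h.seqComplete (hSc y) h.pos.le
  have hFsol : IsVolterraSolution Tbar ι B t₀ (fun t => T t.toNNReal x) (fun t => x + F t) := by
    intro t ht
    obtain ⟨G, hG⟩ := exists_hasWeakIntegral h.seqComplete ht.1 (hTc y).continuousOn
    obtain ⟨J, hJ⟩ := h.exists_isVolterra_const x ht.1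
    have hFG : HasWeakIntegral (fun s => S s.toNNReal y - T s.toNNReal y) 0 t (F t - G) :=
      (hF t ht).sub hG (hSc y) (hTc y)
    have hVF : IsVolterra Tbar ι B F t (F t - G) :=
      h.isVolterra_of_hasWeakIntegral (hSc y) ht.1
        (fun s hs => hF s ⟨hs.1, hs.2.trans ht.2⟩)
        (fun s hs => hsol y s ⟨hs.1, hs.2.trans ht.2⟩) hFG
    have hJG : G - J = T t.toNNReal x - x := by
      have h1 := h.semigroup_ext.hasWeakIntegral_orbit hy ht.1
      have hJ' : HasWeakIntegral (fun s => Tbar s.toNNReal (B x)) 0 t (ι J) := fun Λ => by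
        rw [← hJ Λ, intervalIntegral.integral_comp_sub_left
          (fun s => Λ (Tbar s.toNNReal (B x)))]
        simp
      have hG' : HasWeakIntegral (fun s => Tbar s.toNNReal (ι y)) 0 t (ι G) := by
        simp only [h.ext_apply]
        exact hG.map (ι.restrictScalars ℝ)
      have h2 := hG'.sub hJ' (h.semigroup_ext.continuous_orbit_real _)
        (h.semigroup_ext.continuous_orbit_real _)
      simp only [← map_sub] at h2
      rw [h.ext_apply, ← map_sub] at h1
      exact h.injective (h2.unique h1)
    have := h.isVolterra_add continuous_const hFc hJ hVF
    have e : J + (F t - G) = x + F t - T t.toNNReal x := by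
      rw [show J + (F t - G) = F t - (G - J) by abel, hJG]; abel
    rwa [e] at this
  have : S t.toNNReal x = x + F t :=
    h.solution_unique ⟨h.pos.le, le_rfl⟩ (hSc x) (continuous_const.add hFc) (hsol x) hFsol ht
  rw [this, add_sub_cancel_left]
  exact hF t ht

/-- The perturbed semigroup is generated by the part in `X` of the perturbed operator `P`. -/
theorem isGenerator_iff (h : IsAdmissiblePerturbation Γ T Tbar ι B t₀)
    (hS : IsLocallyEquicontinuousC0Semigroup S)
    (hsol : ∀ x, IsVolterraSolution Tbar ι B t₀ (fun t => T t.toNNReal x)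
      (fun t => S t.toNNReal x)) {P : X → Xbar}
    (hP : ∀ x, Tendsto (fun t : ℝ≥0 => (t : ℝ)⁻¹ • (Tbar t (ι x) - ι x)) (𝓝[>] 0)
      (𝓝 (P x - B x))) (x y : X) :
    ι y = P x ↔ Tendsto (fun t : ℝ≥0 => (t : ℝ)⁻¹ • (S t x - x)) (𝓝[>] 0) (𝓝 y) := by
  constructor
  · intro hxy
    have hy := hP x
    rw [← hxy] at hy
    have hlim := (tendsto_inv_smul_of_hasWeakIntegral h.pos
      (hS.continuous_orbit_real y).continuousOn fun t ht =>
        h.hasWeakIntegral_solution hS hsol hy ⟨ht.1.le, ht.2⟩).comp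
      NNReal.tendsto_coe_nhdsGT_zero
    simpa [Function.comp_def, hS.map_zero] using hlim
  · intro hy
    have h1 := (ι.continuous.tendsto y).comp hy
    have h2 := h.tendsto_of_solution hS (hsol x) (hP x)
    rw [sub_add_cancel] at h2
    exact tendsto_nhds_unique h1 h2

end IsAdmissiblePerturbation

end Perturbed

end Generator

/-! ### The perturbation theorem -/

theorem theorem2p1 {𝕜 X Xbar : Type*} [RCLike 𝕜]
    -- `X` is a sequentially complete (Hausdorff) locally convex space
    [AddCommGroup X] [Module 𝕜 X] [Module ℝ X] [IsScalarTower ℝ 𝕜 X]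
    [UniformSpace X] [IsUniformAddGroup X] [ContinuousSMul 𝕜 X] [LocallyConvexSpace ℝ X]
    [T2Space X] (hX : SeqComplete X)
    -- so is `Xbar`
    [AddCommGroup Xbar] [Module 𝕜 Xbar] [Module ℝ Xbar] [IsScalarTower ℝ 𝕜 Xbar]
    [UniformSpace Xbar] [IsUniformAddGroup Xbar] [ContinuousSMul 𝕜 Xbar]
    [LocallyConvexSpace ℝ Xbar] [T2Space Xbar] (hXbar : SeqComplete Xbar)
    (Γ : Set (Seminorm 𝕜 X)) (hΓ : IsFundamentalSystem Γ)
    -- the generator `A` of the semigroup `T` on `X`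
    (T : ℝ≥0 → X →L[𝕜] X) (hT : IsLocallyEquicontinuousC0Semigroup T)
    (A : X →ₗ.[𝕜] X) (hA : IsGeneratorOf A T)
    -- `X` is continuously and densely included in `Xbar`
    (ι : X →L[𝕜] Xbar) (hι : Function.Injective ι) (hιd : DenseRange ι)
    -- the generator `Abar`, with domain `X`, of the extended semigroup `Tbar` on `Xbar`
    (Tbar : ℝ≥0 → Xbar →L[𝕜] Xbar) (hTbar : IsLocallyEquicontinuousC0Semigroup Tbar)
    (Abar : Xbar →ₗ.[𝕜] Xbar) (hAbar : IsGeneratorOf Abar Tbar)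
    (hext : ∀ (t : ℝ≥0) (x : X), Tbar t (ι x) = ι (T t x))
    (hdom : Abar.domain = LinearMap.range (ι : X →ₗ[𝕜] Xbar))
    (B : X →L[𝕜] Xbar) (t₀ : ℝ) (ht₀ : 0 < t₀)
    -- the integral lies in `X`
    (hc : ∀ f : ℝ → X, ContinuousOn f (Set.Icc 0 t₀) →
      ∃ x : X, HasRiemannIntegral
        (fun t => Tbar (Real.toNNReal (t₀ - t)) (B (f t))) 0 t₀ (ι x))
    -- the integral satisfies the estimate with constant `K < 1` depending on `p`
    (hd : ∀ p ∈ Γ, ∃ K : ℝ, 0 < K ∧ K < 1 ∧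
      ∀ f : ℝ → X, ContinuousOn f (Set.Icc 0 t₀) →
        ∀ x : X, HasRiemannIntegral
          (fun t => Tbar (Real.toNNReal (t₀ - t)) (B (f t))) 0 t₀ (ι x) →
            p x ≤ K * ⨆ t : Set.Icc (0 : ℝ) t₀, p (f t)) :
    (∃ S : ℝ≥0 → X →L[𝕜] X, IsLocallyEquicontinuousC0Semigroup S ∧
        IsGeneratorOf (partIn ι hι (perturbedOperator ι Abar hdom B)) S) ↔
      Dense ((partIn ι hι (perturbedOperator ι Abar hdom B)).domain : Set X) := by

  have : ContinuousSMul ℝ X := IsScalarTower.continuousSMul 𝕜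
  have : ContinuousSMul ℝ Xbar := IsScalarTower.continuousSMul 𝕜
  have hkc : ∀ f : ℝ → X, Continuous f →
      Continuous fun t : ℝ => Tbar (Real.toNNReal (t₀ - t)) (B (f t)) := fun f hf =>
    hTbar.continuous_uncurry.comp
      ((continuous_real_toNNReal.comp (by fun_prop)).prodMk (B.continuous.comp hf))
  have hvol : ∀ f : ℝ → X, Continuous f → ∃ x : X,
      HasRiemannIntegral (fun t => Tbar (Real.toNNReal (t₀ - t)) (B (f t))) 0 t₀ (ι x) ∧
        IsVolterra Tbar ι B f t₀ x := fun f hf => by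
    obtain ⟨x, hx⟩ := hc f hf.continuousOn
    exact ⟨x, hx, hx.hasWeakIntegral ht₀.le (hkc f hf).continuousOn⟩
  have h : IsAdmissiblePerturbation Γ T Tbar ι B t₀ :=
    { seqComplete := hX
      fundamental := hΓ
      semigroup := hT
      semigroup_ext := hTbar
      injective := hι
      ext_apply := hext
      pos := ht₀
      orbit_integral_mem := fun y t ht => by
        obtain ⟨w, hw⟩ := exists_hasWeakIntegral hXbar ht
          (hTbar.continuous_orbit_real y).continuousOn
        have hmem : w ∈ Abar.domain := LinearPMap.mem_domain_of_mem_graph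
          ((hAbar _ _).2 (hTbar.tendsto_of_hasWeakIntegral_orbit ht hw))
        rw [hdom] at hmem
        obtain ⟨x, rfl⟩ := hmem
        exact ⟨x, hw⟩
      volterra_mem := fun f hf => (hvol f hf).imp fun x hx => hx.2
      volterra_bound := fun p hp => by
        obtain ⟨K, hK0, hK1, hK⟩ := hd p hp
        refine ⟨K, hK0, hK1, fun f hf x hx M hM => ?_⟩
        obtain ⟨x', hx', hxw⟩ := hvol f hf
        obtain rfl : x = x' := hι (HasWeakIntegral.unique hx hxw)
        have : Nonempty (Icc (0 : ℝ) t₀) := ⟨⟨0, le_rfl, ht₀.le⟩⟩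
        exact (hK f hf.continuousOn x hx').trans
          (mul_le_mul_of_nonneg_left (ciSup_le fun t => hM t t.2) hK0.le) }
  constructor
  · rintro ⟨S, hS, hgen⟩
    exact hgen.dense_domain hX hS
  · intro _
    obtain ⟨S, hS, hsol⟩ := h.exists_perturbed_semigroup
    refine ⟨S, hS, fun x y => ?_⟩
    rw [mem_graph_partIn]
    refine h.isGenerator_iff hS hsol (fun x => ?_) x y
    have hx : ι x ∈ Abar.domain := hdom ▸ LinearMap.mem_range_self (ι : X →ₗ[𝕜] Xbar) x
    rw [perturbedOperator_apply ι Abar hdom B x hx, add_sub_cancel_right]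
    exact (hAbar _ _).1 (LinearPMap.mem_graph Abar ⟨ι x, hx⟩)
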